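/- A generalized Baumslag--Solitar (GBS) group is a group isomorphic to the fundamental group of a finite connected graph of groups all of whose vertex and edge groups are isomorphic to $\mathbb{Z}$. For a finitely generated group $G$, let $S(G)$ be the sphere of non-zero homomorphisms $\varphi\colon G\to\mathbb{R}$ modulo multiplication by positive reals. For $H\subset G$, let $S(G,H)=\{[\varphi]\in S(G) : \varphi(H)=0\}$, with complement $S(G,H)^c$ in $S(G)$. The BNS invariant $\Sigma(G)\subset S(G)$ is the set of classes $[\varphi]$ such that the subgraph of the Cayley graph of $G$ with respect to some (equivalently, every) finite generating set induced on the vertices in $\varphi^{-1}([0,\infty))$ is connected. A subsphere of $S(G)$ of codimension $k$ is the set of classes of non-zero elements of a linear subspace of codimension $k$ of $\operatorname{Hom}(G,\mathbb{R})$; it is rationally defined if this subspace is defined by finitely many linear equations $\sum_i q_i\varphi(g_i)=0$ with $q_i\in\mathbb{Q}$ and $g_i\in G$. Let $G$ be a non-solvable GBS group, and let $Z(G)$ be its center. Then $$\Sigma(G)=S(G,Z(G))^c.$$ If $Z(G)$ is trivial, then $\Sigma(G)=\emptyset$. If $Z(G)$ is non-trivial, then $\Sigma(G)$ is the complement in $S(G)$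 of a rationally defined subsphere of codimension 1. -/

import Mathlib

/-! ### Fundamental groups of graphs of groups, GBS groups -/

/-- A graph of groups over a nonempty connected graph with vertex set `V` and set of (unoriented)
edges `E`; loops and multiple edges are allowed. An orientation of each edge is chosen, so that `e`
goes from `src e` to `tgt e`. The edge group of `e` embeds in the groups of both endpoints. -/
structure GraphOfGroups.{u, v, w} (V : Type u) (E : Type v) where
  src : E → V
  tgt : E → V
  nonempty : Nonempty V
  connected : ∀ u v : V, Relation.EqvGen (fun a b => ∃ e, src e = a ∧ tgt e = b) u v
  vertexGroup : V → Type w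
  edgeGroup : E → Type w
  [vertexInst : ∀ v, Group (vertexGroup v)]
  [edgeInst : ∀ e, Group (edgeGroup e)]
  inclSrc : ∀ e, edgeGroup e →* vertexGroup (src e)
  inclTgt : ∀ e, edgeGroup e →* vertexGroup (tgt e)
  inclSrc_injective : ∀ e, Function.Injective (inclSrc e)
  inclTgt_injective : ∀ e, Function.Injective (inclTgt e)

namespace GraphOfGroups

variable {V E : Type*} (Γ : GraphOfGroups V E)

instance (v : V) : Group (Γ.vertexGroup v) := Γ.vertexInst v

instance (e : E) : Group (Γ.edgeGroup e) := Γ.edgeInst e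

/-- The edges in `T` connect all the vertices. -/
def Spans (T : Set E) : Prop :=
  ∀ u v : V, Relation.EqvGen (fun a b => ∃ e ∈ T, Γ.src e = a ∧ Γ.tgt e = b) u v

/-- `T` is the set of edges of a spanning (i.e. maximal) tree of the underlying graph: it connects
all the vertices, and no edge of `T` can be removed. -/
def IsSpanningTree (T : Set E) : Prop :=
  Γ.Spans T ∧ ∀ e ∈ T, ¬ Γ.Spans (T \ {e})

/-- The free product of all the vertex groups and of the free group on the stable letters `t_e`. -/
abbrev FreeProd : Type _ :=
  Monoid.Coprod (Monoid.CoprodI Γ.vertexGroup) (FreeGroup E)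

/-- A vertex group element as an element of the free product. -/
def vert (v : V) (x : Γ.vertexGroup v) : Γ.FreeProd := Monoid.Coprod.inl (Monoid.CoprodI.of x)

/-- The stable letter of an edge. -/
def letter (e : E) : Γ.FreeProd := Monoid.Coprod.inr (FreeGroup.of e)

/-- The relators of the fundamental group: `t_e⁻¹ a t_e = a` for `a` in the edge group of `e`, where
the first `a` is viewed in the group of `src e` and the second one in the group of `tgt e`; and
`t_e = 1` for `e ∈ T`. -/
def relators (T : Set E) : Set Γ.FreeProd :=
  {r | ∃ (e : E) (a : Γ.edgeGroup e),
      r = (Γ.letter e)⁻¹ * Γ.vert _ (Γ.inclSrc e a) * Γ.letter e *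
        (Γ.vert _ (Γ.inclTgt e a))⁻¹} ∪
  {r | ∃ e ∈ T, r = Γ.letter e}

/-- The fundamental group of a graph of groups, with respect to a spanning tree `T`. -/
abbrev FundamentalGroup (T : Set E) : Type _ :=
  Γ.FreeProd ⧸ Subgroup.normalClosure (Γ.relators T)

end GraphOfGroups

/-- `G` is a generalized Baumslag-Solitar (GBS) group: it is isomorphic to the fundamental group of
a finite graph of groups all of whose vertex and edge groups are infinite cyclic. -/
def IsGBS (G : Type*) [Group G] : Prop :=
  ∃ (V E : Type) (_ : Finite V) (_ : Finite E) (Γ : GraphOfGroups.{0, 0, 0} V E) (T : Set E),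
    Γ.IsSpanningTree T ∧
    (∀ v, Nonempty (Γ.vertexGroup v ≃* Multiplicative ℤ)) ∧
    (∀ e, Nonempty (Γ.edgeGroup e ≃* Multiplicative ℤ)) ∧
    Nonempty (G ≃* Γ.FundamentalGroup T)

/-! ### The sphere `S(G)` and the BNS invariant -/

/-- The real vector space of homomorphisms from `G` to `ℝ`. -/
abbrev Character (G : Type*) [Group G] : Type _ := Additive G →+ ℝ

/-- The sphere `S(G)` of non-zero homomorphisms `G → ℝ` modulo multiplication by positive reals. -/
abbrev CharacterSphere (G : Type*) [Group G] : Type _ := Module.Ray ℝ (Character G)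

section BNS

variable {G : Type*} [Group G]

/-- The subsphere `S(G, H)` of the classes `[φ]` with `H ⊆ ker φ`. -/
def subsphere (H : Set G) : Set (CharacterSphere G) :=
  {x | ∃ (φ : Character G) (hφ : φ ≠ 0),
    x = rayOfNeZero ℝ φ hφ ∧ ∀ h ∈ H, φ (Additive.ofMul h) = 0}

/-- The subgraph of the Cayley graph of `G` with respect to `S` induced on `φ⁻¹([0, ∞))`. -/
def nonnegCayley (S : Set G) (φ : Character G) :
    SimpleGraph {g : G | 0 ≤ φ (Additive.ofMul g)} :=
  (SimpleGraph.mulCayley S).induce {g : G | 0 ≤ φ (Additive.ofMul g)}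

variable (G) in
/-- The Bieri-Neumann-Strebel invariant `Σ(G)` of a finitely generated group `G`: the set of the
classes `[φ]` such that the part of the Cayley graph of `G` lying over `[0, ∞)` is connected, for
some (equivalently, for every) finite generating set. -/
def bnsInvariant : Set (CharacterSphere G) :=
  {x | ∃ (φ : Character G) (hφ : φ ≠ 0), x = rayOfNeZero ℝ φ hφ ∧
    ∃ S : Set G, S.Finite ∧ Subgroup.closure S = ⊤ ∧ (nonnegCayley S φ).Connected}

/-- A subspace of the space of characters is rationally defined if it is the set of solutions of
finitely many linear equations, each of them being a rational combination of evaluations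
`φ ↦ φ g`. -/
def IsRationallyDefined (W : Submodule ℝ (Character G)) : Prop :=
  ∃ F : Set (G →₀ ℚ), F.Finite ∧
    ∀ φ : Character G, φ ∈ W ↔
      ∀ f ∈ F, (f.sum fun g q => (q : ℝ) * φ (Additive.ofMul g)) = 0

/-- `Y` is a rationally defined subsphere of `S(G)` of codimension `k`: it consists of the classes
of the non-zero elements of a rationally defined subspace of codimension `k`. -/
def IsRationalSubsphere (k : ℕ) (Y : Set (CharacterSphere G)) : Prop :=
  ∃ W : Submodule ℝ (Character G), IsRationallyDefined W ∧
    Module.rank ℝ (Character G ⧸ W) = k ∧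
    Y = {x | ∃ (φ : Character G) (hφ : φ ≠ 0), x = rayOfNeZero ℝ φ hφ ∧ φ ∈ W}

end BNS

/-! ### The definitions do not depend on the choices -/

namespace BNSAux

variable {G : Type*} [Group G]

/-- `g` and `h` lie in the same component of the non-negative part of the Cayley graph. -/
def Joined (S : Set G) (φ : Character G) (g h : G) : Prop :=
  ∃ (hg : 0 ≤ φ (Additive.ofMul g)) (hh : 0 ≤ φ (Additive.ofMul h)),
    (nonnegCayley S φ).Reachable ⟨g, hg⟩ ⟨h, hh⟩

variable {S S' : Set G} {φ : Character G}

lemma Joined.symm {g h : G} (H : Joined S φ g h) : Joined S φ h g := by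
  obtain ⟨a, b, c⟩ := H
  exact ⟨b, a, c.symm⟩

lemma Joined.trans {g h k : G} (H : Joined S φ g h) (H' : Joined S φ h k) : Joined S φ g k := by
  obtain ⟨a, b, c⟩ := H
  obtain ⟨a', b', c'⟩ := H'
  exact ⟨a, b', c.trans c'⟩

lemma joined_refl {g : G} (hg : 0 ≤ φ (Additive.ofMul g)) : Joined S φ g g :=
  ⟨hg, hg, SimpleGraph.Reachable.refl _⟩

lemma joined_mul {g s : G} (hs : s ∈ S) (hg : 0 ≤ φ (Additive.ofMul g))
    (hh : 0 ≤ φ (Additive.ofMul (g * s))) : Joined S φ g (g * s) := by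
  by_cases h : g = g * s
  · rw [← h]
    exact joined_refl hg
  · refine ⟨hg, hh, SimpleGraph.Adj.reachable ?_⟩
    simp only [nonnegCayley, SimpleGraph.comap_adj, Function.Embedding.subtype_apply]
    rw [SimpleGraph.mulCayley_adj']
    exact ⟨h, s, hs, Or.inl rfl⟩

lemma exists_bound (hS : Subgroup.closure S = ⊤) (x : G) :
    ∃ C : ℝ, ∀ g : G, C ≤ φ (Additive.ofMul g) → Joined S φ g (g * x) := by
  have hx : x ∈ Subgroup.closure S := by simp [hS]
  induction hx using Subgroup.closure_induction with
  | mem s hs =>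
    refine ⟨|φ (Additive.ofMul s)|, fun g hg => joined_mul hs ((abs_nonneg _).trans hg) ?_⟩
    rw [ofMul_mul, map_add]
    linarith [neg_abs_le (φ (Additive.ofMul s))]
  | one =>
    refine ⟨0, fun g hg => ?_⟩
    rw [mul_one]
    exact joined_refl hg
  | mul x y _ _ hx hy =>
    obtain ⟨C, hC⟩ := hx
    obtain ⟨D, hD⟩ := hy
    refine ⟨max C (D - φ (Additive.ofMul x)), fun g hg => ?_⟩
    have h1 := hC g ((le_max_left _ _).trans hg)
    have h2 := hD (g * x) (by
      rw [ofMul_mul, map_add]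
      linarith [(le_max_right C (D - φ (Additive.ofMul x))).trans hg])
    rw [← mul_assoc]
    exact h1.trans h2
  | inv x _ hx =>
    obtain ⟨C, hC⟩ := hx
    refine ⟨C + φ (Additive.ofMul x), fun g hg => ?_⟩
    have h1 := hC (g * x⁻¹) (by
      rw [ofMul_mul, map_add, ofMul_inv, map_neg]
      linarith)
    rw [inv_mul_cancel_right] at h1
    exact h1.symm

lemma exists_pos (hφ : φ ≠ 0) (hS : Subgroup.closure S = ⊤) :
    ∃ t : G, 0 < φ (Additive.ofMul t) ∧ ∀ g, 0 ≤ φ (Additive.ofMul g) →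
      Joined S φ g (g * t) := by
  obtain ⟨s, hs, h0⟩ : ∃ s ∈ S, φ (Additive.ofMul s) ≠ 0 := by
    by_contra! h
    apply hφ
    refine AddMonoidHom.ext fun y => ?_
    obtain ⟨x, rfl⟩ := Additive.ofMul.surjective y
    change φ (Additive.ofMul x) = 0
    have hx : x ∈ Subgroup.closure S := by simp [hS]
    induction hx using Subgroup.closure_induction with
    | mem s hs => exact h s hs
    | one => simp
    | mul x y _ _ hx hy => rw [ofMul_mul, map_add, hx, hy, add_zero]
    | inv x _ hx => rw [ofMul_inv, map_neg, hx, neg_zero]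
  rcases lt_or_gt_of_ne h0 with h | h
  · refine ⟨s⁻¹, by rw [ofMul_inv, map_neg]; linarith, fun g hg => ?_⟩
    have h1 : 0 ≤ φ (Additive.ofMul (g * s⁻¹)) := by
      rw [ofMul_mul, map_add, ofMul_inv, map_neg]
      linarith
    have h2 := joined_mul (φ := φ) hs h1 (by rwa [inv_mul_cancel_right])
    rw [inv_mul_cancel_right] at h2
    exact h2.symm
  · refine ⟨s, h, fun g hg => joined_mul hs hg ?_⟩
    rw [ofMul_mul, map_add]
    linarith

lemma connected_of_connected (hφ : φ ≠ 0) (hf : S.Finite)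
    (hS' : Subgroup.closure S' = ⊤) (hc : (nonnegCayley S φ).Connected) :
    (nonnegCayley S' φ).Connected := by
  obtain ⟨t, ht, htJ⟩ := exists_pos hφ hS'
  choose C hC using exists_bound (φ := φ) hS'
  obtain ⟨B, hB⟩ := (hf.image C).bddAbove
  obtain ⟨N, hN⟩ := Archimedean.arch B ht
  have hp : B ≤ φ (Additive.ofMul (t ^ N)) := by
    rwa [ofMul_pow, map_nsmul]
  have hp0 : 0 ≤ φ (Additive.ofMul (t ^ N)) := by
    rw [ofMul_pow, map_nsmul]
    exact nsmul_nonneg ht.le _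
  have hpow : ∀ (n : ℕ) (g : G), 0 ≤ φ (Additive.ofMul g) → Joined S' φ g (g * t ^ n) := by
    intro n
    induction n with
    | zero => intro g hg; simpa using joined_refl hg
    | succ n ih =>
      intro g hg
      have h1 := ih g hg
      rw [pow_succ, ← mul_assoc]
      exact h1.trans (htJ _ h1.2.1)
  have hstep : ∀ a b : {g : G | 0 ≤ φ (Additive.ofMul g)}, (nonnegCayley S φ).Adj a b →
      Joined S' φ (t ^ N * a) (t ^ N * b) := by
    intro a b hab
    have key : ∀ c : G, 0 ≤ φ (Additive.ofMul c) → ∀ s ∈ S,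
        Joined S' φ (t ^ N * c) (t ^ N * (c * s)) := by
      intro c hc s hs
      rw [← mul_assoc]
      apply hC
      have := hB (Set.mem_image_of_mem C hs)
      rw [ofMul_mul, map_add]
      linarith
    simp only [nonnegCayley, SimpleGraph.comap_adj, Function.Embedding.subtype_apply] at hab
    rw [SimpleGraph.mulCayley_adj'] at hab
    obtain ⟨_, s, hs, h | h⟩ := hab
    · rw [← h]
      exact key _ a.2 s hs
    · rw [h]
      exact (key _ b.2 s hs).symm
  have hwalk : ∀ a b : {g : G | 0 ≤ φ (Additive.ofMul g)}, (nonnegCayley S φ).Walk a b →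
      Joined S' φ (t ^ N * a) (t ^ N * b) := by
    intro a b w
    induction w with
    | @nil u =>
      refine joined_refl ?_
      rw [ofMul_mul, map_add]
      exact add_nonneg hp0 u.2
    | cons h _ ih => exact (hstep _ _ h).trans ih
  have hone : (0 : ℝ) ≤ φ (Additive.ofMul (1 : G)) := by simp
  have hmain : ∀ g : G, 0 ≤ φ (Additive.ofMul g) → Joined S' φ 1 g := by
    intro g hg
    have h1 := hpow N 1 hone
    have h3 := hpow N g hg
    have hh : 0 ≤ φ (Additive.ofMul ((t ^ N)⁻¹ * (g * t ^ N))) := by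
      rw [ofMul_mul, ofMul_mul, map_add, map_add, ofMul_inv, map_neg]
      linarith
    obtain ⟨w⟩ := hc.preconnected ⟨1, hone⟩ ⟨_, hh⟩
    have h2 := hwalk _ _ w
    simp only [mul_inv_cancel_left, mul_one, one_mul] at h1 h2
    exact (h1.trans h2).trans h3.symm
  refine (SimpleGraph.connected_iff _).2 ⟨?_, ⟨⟨1, hone⟩⟩⟩
  rintro ⟨a, ha⟩ ⟨b, hb⟩
  obtain ⟨_, _, h⟩ := (hmain a ha).symm.trans (hmain b hb)
  exact h

lemma exists_smul_of_ray_eq {ψ : Character G} {hφ : φ ≠ 0} {hψ : ψ ≠ 0}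
    (h : rayOfNeZero ℝ φ hφ = rayOfNeZero ℝ ψ hψ) : ∃ r : ℝ, 0 < r ∧ ψ = r • φ := by
  rw [ray_eq_iff] at h
  obtain ⟨r, hr, h⟩ := h.exists_pos_left hφ hψ
  exact ⟨r, hr, h.symm⟩

end BNSAux

/-- Membership of `[φ]` in `Σ(G)` may be tested on the representative `φ` and on any given finite
generating set. -/
lemma mem_bnsInvariant_iff {G : Type*} [Group G] {S : Set G} (hf : S.Finite)
    (hS : Subgroup.closure S = ⊤) (φ : Character G) (hφ : φ ≠ 0) :
    rayOfNeZero ℝ φ hφ ∈ bnsInvariant G ↔ (nonnegCayley S φ).Connected := by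
  constructor
  · rintro ⟨ψ, hψ, h, S', hf', _, hc⟩
    obtain ⟨r, hr, rfl⟩ := BNSAux.exists_smul_of_ray_eq h
    have hset : {g : G | 0 ≤ (r • φ) (Additive.ofMul g)} = {g | 0 ≤ φ (Additive.ofMul g)} := by
      ext g
      simp [hr]
    have hc' : (nonnegCayley S' φ).Connected := by
      unfold nonnegCayley at hc ⊢
      rwa [hset] at hc
    exact BNSAux.connected_of_connected hφ hf' hS hc'
  · intro h
    exact ⟨φ, hφ, rfl, S, hf, hS, h⟩

/-- Membership of `[φ]` in `S(G, H)` may be tested on the representative `φ`. -/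
lemma mem_subsphere_iff {G : Type*} [Group G] (H : Set G) (φ : Character G) (hφ : φ ≠ 0) :
    rayOfNeZero ℝ φ hφ ∈ subsphere H ↔ ∀ h ∈ H, φ (Additive.ofMul h) = 0 := by
  constructor
  · rintro ⟨ψ, hψ, h, hH⟩
    obtain ⟨r, hr, rfl⟩ := BNSAux.exists_smul_of_ray_eq h
    intro g hg
    have := hH g hg
    simpa [hr.ne'] using this
  · intro h
    exact ⟨φ, hφ, rfl, h⟩

/-!
Let `G` be a non-solvable GBS group. Let `M` be the multiple HNN extension of `⟨a⟩ ≅ ℤ` obtained by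
identifying all the vertices of the graph of groups. Its elements have normal forms, on which `M`
is made to act by explicit permutations, and `M` acts on its Bass-Serre tree, with vertex set
`M ⧸ ⟨a⟩`. Evaluating normal forms along paths of the original graph shows that `G` embeds in `M`
(`GBSPresentation.exists_embedding`). Hence `G` acts on a tree with cyclic vertex stabilizers, and
each vertex stabilizer is commensurable to a fixed vertex group `⟨a₀⟩`
(`GBSPresentation.exists_tree`).

If a map `p` from the set of vertices of this tree to itself commutes with the action, and one of
any two adjacent vertices is mapped to the other one by `p`, then any commutator fixes `pᵏ x` for `k`
large, hence `G` is metabelian (`DirectedTree.isSolvable_of_equivariant`). This excludes two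
situations.
* A central element `z` without fixed vertices: let `p x` be the neighbour of `x` in the direction of
  `z x`. Thus every non-trivial central element has a non-trivial power in `⟨a₀⟩`.
* A class `[φ]` in the invariant with `φ a₀ = 0`: let `p x` be the neighbour of `x` in the direction
  of `k x₀`, where `φ k` is large. It does not depend on `k` because the elements with `φ k` large
  can be joined in the Cayley graph without going near `x`.

Now let `φ ≠ 0` vanish on the center. Then `φ a₀ = 0`, as otherwise conjugation would fix powers
of `a₀`, and `a₀` would have a central power; so `[φ]` is not in the invariant. Conversely, if
`φ z ≠ 0` with `z` central, paths can be pushed up by powers of `z`, so `[φ]` is in the invariant.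
If there is a non-trivial central element `z`, then a character vanishes on the center if and only
if it vanishes at `a₀`, if and only if it vanishes at `z`, and the commensurability ratios of the
vertex generators to `a₀` define a character that does not vanish at `a₀`.
-/

/-! ### Trees described by directions -/

/-- A tree with vertex set `X`. Absence of cycles is encoded by the function `dir`: for `w ≠ x`,
`dir x w` is the neighbour of `x` in the direction of `w`, so that distinct neighbours of `x` lie
in distinct components of the complement of `x`. The value `dir x x` is irrelevant. -/
structure DirectedTree (X : Type*) where
  Adj : X → X → Prop
  symm : ∀ {x y}, Adj x y → Adj y x
  ne : ∀ {x y}, Adj x y → x ≠ y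
  conn : ∀ x y, Relation.ReflTransGen Adj x y
  dir : X → X → X
  dir_of_adj : ∀ {x y}, Adj x y → dir x y = y
  dir_congr : ∀ {x w w'}, Adj w w' → w ≠ x → w' ≠ x → dir x w = dir x w'

namespace DirectedTree

variable {X : Type*} (T : DirectedTree X)

lemma dir_eq_or_dir_eq {x y : X} (hxy : T.Adj x y) (w : X) : T.dir x w = y ∨ T.dir y w = x := by
  induction T.conn x w with
  | refl => exact Or.inr (T.dir_of_adj (T.symm hxy))
  | @tail u w _ huw ih =>
    by_cases hwx : w = x
    · subst hwx; exact Or.inr (T.dir_of_adj (T.symm hxy))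
    by_cases hwy : w = y
    · subst hwy; exact Or.inl (T.dir_of_adj hxy)
    by_cases hux : u = x
    · subst hux
      right
      rw [← T.dir_congr huw (T.ne hxy) hwy, T.dir_of_adj (T.symm hxy)]
    by_cases huy : u = y
    · subst huy
      left
      rw [← T.dir_congr huw (T.ne hxy).symm hwx, T.dir_of_adj hxy]
    rw [← T.dir_congr huw hux hwx, ← T.dir_congr huw huy hwy]
    exact ih

/-- The direction function at `x` is determined off `x` by its values at the neighbours of `x` and by
being locally constant. -/
lemma eq_dir {x : X} (f : X → X) (hf : ∀ y, T.Adj x y → f y = y)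
    (hf' : ∀ w w', T.Adj w w' → w ≠ x → w' ≠ x → f w = f w') {w : X} (hw : w ≠ x) :
    f w = T.dir x w := by
  induction T.conn x w with
  | refl => exact absurd rfl hw
  | @tail u w _ huw ih =>
    by_cases hux : u = x
    · subst hux
      rw [hf _ huw, T.dir_of_adj huw]
    · rw [← hf' _ _ huw hux hw, ← T.dir_congr huw hux hw, ih hux]

variable {G : Type*} [Group G] [MulAction G X]

lemma smul_dir (hT : ∀ (g : G) {x y}, T.Adj x y → T.Adj (g • x) (g • y)) (g : G) {x w : X}
    (hw : w ≠ x) : g • T.dir x w = T.dir (g • x) (g • w) := by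
  rw [← T.eq_dir (fun w => g⁻¹ • T.dir (g • x) (g • w)) _ _ hw, smul_inv_smul]
  · intro y hy
    simp only [T.dir_of_adj (hT g hy), inv_smul_smul]
  · intro w w' h hw hw'
    simp only [T.dir_congr (hT g h) ((MulAction.injective g).ne hw)
      ((MulAction.injective g).ne hw')]

/-- If `G` preserves a map `p` moving towards a common end of the tree, and elements fixing a common
vertex commute, then `G` is metabelian: a commutator fixes `pᵏ x` for `k` large. -/
lemma isSolvable_of_equivariant (p : X → X) (hp : ∀ (g : G) x, p (g • x) = g • p x)
    (hpT : ∀ x y, T.Adj x y → p x = y ∨ p y = x)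
    (hcomm : ∀ (g h : G) (x : X), g • x = x → h • x = x → Commute g h) (x : X) :
    Group.IsSolvable G := by
  have hpi : ∀ (k : ℕ) (g : G) (x : X), p^[k] (g • x) = g • p^[k] x := by
    intro k g
    induction k with
    | zero => intro x; rfl
    | succ k ih => intro x; rw [Function.iterate_succ_apply, hp, ih, Function.iterate_succ_apply]
  -- any two orbits of `p` merge
  have hconf : ∀ y, ∃ i j, p^[i] y = p^[j] x := by
    intro y
    induction T.conn x y with
    | refl => exact ⟨0, 0, rfl⟩
    | @tail y w _ hyw ih =>
      obtain ⟨i, j, hij⟩ := ih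
      rcases hpT _ _ hyw with h | h
      · refine ⟨i, j + 1, ?_⟩
        rw [← h, ← Function.iterate_succ_apply, Function.iterate_succ_apply',
          Function.iterate_succ_apply', hij]
      · refine ⟨i + 1, j, ?_⟩
        rw [Function.iterate_succ_apply, h, hij]
  have hmono : ∀ (g : G) (i j k : ℕ), g • p^[i] x = p^[j] x →
      g • p^[k + i] x = p^[k + j] x := by
    intro g i j k h
    rw [Function.iterate_add_apply, ← hpi, h, Function.iterate_add_apply]
  let N : Subgroup G :=
    { carrier := {g | ∃ i, g • p^[i] x = p^[i] x}
      one_mem' := ⟨0, one_smul _ _⟩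
      mul_mem' := by
        rintro a b ⟨i, hi⟩ ⟨j, hj⟩
        refine ⟨i + j, ?_⟩
        have h1 := hmono b j j i hj
        have h2 := hmono a i i j hi
        rw [add_comm j i] at h2
        rw [mul_smul, h1, h2]
      inv_mem' := by
        rintro a ⟨i, hi⟩
        exact ⟨i, by rw [inv_smul_eq_iff, hi]⟩ }
  have hN : commutator G ≤ N := by
    rw [commutator_def, Subgroup.commutator_le]
    intro g _ h _
    obtain ⟨i, j, hg⟩ := hconf (g⁻¹ • x)
    obtain ⟨k, l, hh⟩ := hconf (h⁻¹ • x)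
    rw [hpi] at hg hh
    have e1 : g⁻¹ • h⁻¹ • p^[i + k] x = p^[l + j] x := by
      rw [hmono _ _ _ i hh, add_comm i l, hmono _ _ _ l hg]
    have e2 : h⁻¹ • g⁻¹ • p^[i + k] x = p^[l + j] x := by
      rw [add_comm i k, hmono _ _ _ k hg, add_comm k j, hmono _ _ _ j hh, add_comm]
    refine ⟨i + k, ?_⟩
    rw [commutatorElement_def, mul_smul, mul_smul, mul_smul, e1, ← e2, smul_inv_smul,
      smul_inv_smul]
  rw [Group.isSolvable_def] 
  refine ⟨2, ?_⟩
  rw [eq_bot_iff]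
  change ⁅commutator G, commutator G⁆ ≤ ⊥
  rw [Subgroup.commutator_le]
  intro a ha b hb
  obtain ⟨i, hi⟩ := hN ha
  obtain ⟨j, hj⟩ := hN hb
  have h1 := hmono a i i j hi
  rw [add_comm] at h1
  rw [Subgroup.mem_bot, commutatorElement_eq_one_iff_commute]
  exact hcomm a b _ h1 (hmono b j j i hj)

/-- If a central element `z` has no fixed vertex, then `G` is metabelian: the map sending `x` to its
neighbour in the direction of `z • x` is equivariant. -/
lemma isSolvable_of_central (hT : ∀ (g : G) {x y}, T.Adj x y → T.Adj (g • x) (g • y))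
    (hcomm : ∀ (g h : G) (x : X), g • x = x → h • x = x → Commute g h) (x : X)
    {z : G} (hz : z ∈ Subgroup.center G) (hzx : ∀ x : X, z • x ≠ x) : Group.IsSolvable G := by
  refine T.isSolvable_of_equivariant (fun x => T.dir x (z • x)) (fun g x => ?_) (fun x y h => ?_)
    hcomm x
  · rw [T.smul_dir hT g (hzx x), ← mul_smul, ← mul_smul, Subgroup.mem_center_iff.1 hz g]
  · -- otherwise `z • x` and `z • y` are on the same side of `x` and of `y`
    rcases T.dir_eq_or_dir_eq h (z • x) with h1 | h1
    · exact Or.inl h1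
    · by_cases hy : z • x = y
      · left; simp only [hy, T.dir_of_adj h]
      · right; rw [← T.dir_congr (hT z h) hy (hzx y), h1]

end DirectedTree

/-! ### Characters and the tree -/

/-- If the part of the Cayley graph over `[0, ∞)` is connected, so is the part over
`[φ g₀, ∞)`: functions that are locally constant there are constant. -/
lemma eq_of_nonnegCayley_connected {G : Type*} [Group G] {S : Set G} {φ : Character G}
    (hc : (nonnegCayley S φ).Connected) {α : Type*} (f : G → α) (g₀ : G)
    (hf : ∀ k, ∀ s ∈ S, φ (Additive.ofMul g₀) ≤ φ (Additive.ofMul k) →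
      φ (Additive.ofMul g₀) ≤ φ (Additive.ofMul (k * s)) → f k = f (k * s))
    {k k' : G} (hk : φ (Additive.ofMul g₀) ≤ φ (Additive.ofMul k))
    (hk' : φ (Additive.ofMul g₀) ≤ φ (Additive.ofMul k')) : f k = f k' := by
  have hmul : ∀ k, φ (Additive.ofMul g₀) ≤ φ (Additive.ofMul k) ↔
      0 ≤ φ (Additive.ofMul (g₀⁻¹ * k)) := by
    intro k
    rw [ofMul_mul, map_add, ofMul_inv, map_neg]
    constructor <;> intro h <;> linarith
  have key : ∀ a b : {g : G | 0 ≤ φ (Additive.ofMul g)}, (nonnegCayley S φ).Walk a b →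
      f (g₀ * a) = f (g₀ * b) := by
    intro a b w
    induction w with
    | nil => rfl
    | @cons u v _ h _ ih =>
      rw [← ih]
      simp only [nonnegCayley, SimpleGraph.comap_adj, Function.Embedding.subtype_apply] at h
      rw [SimpleGraph.mulCayley_adj'] at h
      have hu : φ (Additive.ofMul g₀) ≤ φ (Additive.ofMul (g₀ * u)) := by
        rw [hmul, inv_mul_cancel_left]; exact u.2
      have hv : φ (Additive.ofMul g₀) ≤ φ (Additive.ofMul (g₀ * v)) := by
        rw [hmul, inv_mul_cancel_left]; exact v.2
      obtain ⟨_, s, hs, h | h⟩ := h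
      · rw [← h, ← mul_assoc] at hv ⊢
        exact hf _ s hs hu hv
      · rw [h, ← mul_assoc] at hu ⊢
        exact (hf _ s hs hv hu).symm
  obtain ⟨w⟩ := hc.preconnected ⟨g₀⁻¹ * k, (hmul k).1 hk⟩ ⟨g₀⁻¹ * k', (hmul k').1 hk'⟩
  simpa using key _ _ w

lemma exists_le_character {G : Type*} [Group G] {φ : Character G} (hφ : φ ≠ 0) (C : ℝ) :
    ∃ g : G, C ≤ φ (Additive.ofMul g) := by
  obtain ⟨g, hg⟩ : ∃ g : G, 0 < φ (Additive.ofMul g) := by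
    by_contra! h
    refine hφ (AddMonoidHom.ext fun y => le_antisymm (h y.toMul) ?_)
    have := h (y.toMul)⁻¹
    rw [ofMul_inv, map_neg] at this
    exact neg_nonpos.1 this
  obtain ⟨N, hN⟩ := Archimedean.arch C hg
  exact ⟨g ^ N, by rwa [ofMul_pow, map_nsmul]⟩

/-- A character vanishing on vertex stabilizers whose class is in the BNS invariant singles out an
end of the tree: from any vertex `x`, all the `k • x₀` with `φ k` large are in the same
direction. -/
lemma DirectedTree.isSolvable_of_nonnegCayley_connected {G X : Type*} [Group G] [MulAction G X]
    (T : DirectedTree X) (hT : ∀ (g : G) {x y}, T.Adj x y → T.Adj (g • x) (g • y))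
    (hcomm : ∀ (g h : G) (x : X), g • x = x → h • x = x → Commute g h) (x₀ : X)
    {S : Set G} (hS : S.Finite) {φ : Character G} (hφ : φ ≠ 0)
    (hc : (nonnegCayley S φ).Connected)
    (hstab : ∀ (g : G) (x : X), g • x = x → φ (Additive.ofMul g) = 0) : Group.IsSolvable G := by
  have hne : ∀ x w : X, ∃ C : ℝ, ∀ k : G, C ≤ φ (Additive.ofMul k) → k • w ≠ x := by
    intro x w
    by_cases h : ∃ k₁ : G, k₁ • w = x
    · obtain ⟨k₁, hk₁⟩ := h
      refine ⟨φ (Additive.ofMul k₁) + 1, fun k hk hkw => ?_⟩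
      have := hstab (k₁⁻¹ * k) w (by rw [mul_smul, hkw, ← hk₁, inv_smul_smul])
      rw [ofMul_mul, map_add, ofMul_inv, map_neg] at this
      linarith
    · push Not at h
      exact ⟨0, fun k _ => h k⟩
  have hdir : ∀ x w w' : X, ∃ C : ℝ, ∀ k : G, C ≤ φ (Additive.ofMul k) →
      T.dir x (k • w) = T.dir x (k • w') := by
    intro x w w'
    induction T.conn w w' with
    | refl => exact ⟨0, fun _ _ => rfl⟩
    | @tail u v _ huv ih =>
      obtain ⟨C, hC⟩ := ih
      obtain ⟨C₁, hC₁⟩ := hne x u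
      obtain ⟨C₂, hC₂⟩ := hne x v
      refine ⟨max C (max C₁ C₂), fun k hk => ?_⟩
      simp only [max_le_iff] at hk
      rw [hC k hk.1]
      exact T.dir_congr (hT k huv) (hC₁ k hk.2.1) (hC₂ k hk.2.2)
  have hend : ∀ x : X, ∃ (y : X) (C : ℝ), ∀ k : G, C ≤ φ (Additive.ofMul k) →
      k • x₀ ≠ x ∧ T.dir x (k • x₀) = y := by
    intro x
    choose C hC using fun s : G => hdir x x₀ (s • x₀)
    obtain ⟨B, hB⟩ := (hS.image C).bddAbove
    obtain ⟨C₁, hC₁⟩ := hne x x₀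
    obtain ⟨g₀, hg₀⟩ := exists_le_character hφ (max B C₁)
    rw [max_le_iff] at hg₀
    refine ⟨T.dir x (g₀ • x₀), φ (Additive.ofMul g₀), fun k hk =>
      ⟨hC₁ k (hg₀.2.trans hk), ?_⟩⟩
    refine eq_of_nonnegCayley_connected hc (fun k => T.dir x (k • x₀)) g₀ ?_ hk le_rfl
    intro k s hs hk _
    simp only [mul_smul]
    exact hC s k ((hB (Set.mem_image_of_mem C hs)).trans (hg₀.1.trans hk))
  choose p C hp using hend
  refine T.isSolvable_of_equivariant p (fun g x => ?_) (fun x y hxy => ?_) hcomm x₀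
  · obtain ⟨k, hk⟩ := exists_le_character hφ (max (C (g • x)) (C x + φ (Additive.ofMul g)))
    rw [max_le_iff] at hk
    have h1 := hp (g • x) k hk.1
    have h2 := hp x (g⁻¹ * k) (by
      rw [ofMul_mul, map_add, ofMul_inv, map_neg]; linarith [hk.2])
    rw [← h1.2, ← h2.2, T.smul_dir hT g h2.1, mul_smul, smul_inv_smul]
  · obtain ⟨k, hk⟩ := exists_le_character hφ (max (C x) (C y))
    rw [max_le_iff] at hk
    rw [← (hp x k hk.1).2, ← (hp y k hk.2).2]
    exact T.dir_eq_or_dir_eq hxy _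

/-! ### Normal forms for multiple HNN extensions of an infinite cyclic group -/

/-- Data for the group `⟨a, t_d | t_{rev d} = t_d⁻¹, t_d⁻¹ a ^ label d t_d = a ^ label (rev d)⟩`,
the fundamental group of a graph of infinite cyclic groups with a single vertex. The elements of `D`
are the oriented loops. -/
structure LabelledRose (D : Type) where
  rev : D → D
  rev_rev : ∀ d, rev (rev d) = d
  label : D → ℤ
  label_ne_zero : ∀ d, label d ≠ 0

namespace LabelledRose

variable {D : Type} (R : LabelledRose D)

/-- The list `[(c₁, d₁), …, (cᵣ, dᵣ)]`, standing for `a ^ c₁ t_{d₁} ⋯ a ^ cᵣ t_{dᵣ}`, is reduced: the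
exponents `cᵢ` are standard residues modulo `label dᵢ`, and no `t_d a ^ 0 t_{rev d}` occurs. -/
def Reduced : List (ℤ × D) → Prop
  | [] => True
  | x :: l => (0 ≤ x.1 ∧ x.1 < |R.label x.2|) ∧ l.head? ≠ some (0, R.rev x.2) ∧ Reduced l

/-- Left multiplication by `a ^ k` on reduced words: `a ^ k` is carried through the letters, using
the relation `a ^ label d t_d = t_d a ^ label (rev d)`. The second component is the power of `a`
that comes out at the right end. -/
def shift : List (ℤ × D) → ℤ → List (ℤ × D) × ℤ
  | [], k => ([], k)
  | x :: l, k =>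
    let r := shift l ((x.1 + k) / R.label x.2 * R.label (R.rev x.2))
    (((x.1 + k) % R.label x.2, x.2) :: r.1, r.2)

@[simp] lemma shift_nil (k : ℤ) : R.shift [] k = ([], k) := rfl

lemma shift_cons (x : ℤ × D) (l : List (ℤ × D)) (k : ℤ) : R.shift (x :: l) k =
    (((x.1 + k) % R.label x.2, x.2) ::
        (R.shift l ((x.1 + k) / R.label x.2 * R.label (R.rev x.2))).1,
      (R.shift l ((x.1 + k) / R.label x.2 * R.label (R.rev x.2))).2) := rfl

lemma shift_zero {l : List (ℤ × D)} (hl : R.Reduced l) : R.shift l 0 = (l, 0) := by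
  induction l with
  | nil => rfl
  | cons x l ih =>
    obtain ⟨⟨h0, h1⟩, -, h3⟩ := hl
    have hm : x.1 % R.label x.2 = x.1 := by
      rw [← Int.emod_abs, Int.emod_eq_of_lt h0 h1]
    have hd : x.1 / R.label x.2 = 0 := by
      have := Int.emod_add_mul_ediv x.1 (R.label x.2)
      rw [hm] at this
      have : R.label x.2 * (x.1 / R.label x.2) = 0 := by linarith
      exact (mul_eq_zero.1 this).resolve_left (R.label_ne_zero _)
    rw [shift_cons, add_zero, hm, hd, zero_mul, ih h3]

lemma shift_add (l : List (ℤ × D)) (j k : ℤ) :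
    R.shift l (j + k) = ((R.shift (R.shift l k).1 j).1,
      (R.shift (R.shift l k).1 j).2 + (R.shift l k).2) := by
  induction l generalizing j k with
  | nil => rfl
  | cons x l ih =>
    have e : (x.1 + (j + k)) = ((x.1 + k) % R.label x.2 + j) +
        R.label x.2 * ((x.1 + k) / R.label x.2) := by
      linarith [Int.emod_add_mul_ediv (x.1 + k) (R.label x.2)]
    have h1 : (x.1 + (j + k)) % R.label x.2 = ((x.1 + k) % R.label x.2 + j) % R.label x.2 := by
      rw [e, Int.add_mul_emod_self_left]
    have h2 : (x.1 + (j + k)) / R.label x.2 = ((x.1 + k) % R.label x.2 + j) / R.label x.2 +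
        (x.1 + k) / R.label x.2 := by
      rw [e, Int.add_mul_ediv_left _ _ (R.label_ne_zero _)]
    simp only [shift_cons]
    rw [h1, h2, add_mul, ih]

lemma head_shift_ne {d : D} {l : List (ℤ × D)} (hl : R.Reduced l)
    (h : l.head? ≠ some (0, R.rev d)) (j : ℤ) :
    (R.shift l (j * R.label (R.rev d))).1.head? ≠ some (0, R.rev d) := by
  cases l with
  | nil => simp
  | cons x l =>
    obtain ⟨⟨h0, h1⟩, -, -⟩ := hl
    intro h'
    simp only [shift_cons, List.head?_cons, Option.some.injEq, Prod.mk.injEq] at h'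
    obtain ⟨h2, h3⟩ := h'
    rw [← h3, Int.add_mul_emod_self_right, ← Int.emod_abs, Int.emod_eq_of_lt h0 h1] at h2
    exact h (by rw [List.head?_cons, ← h2, ← h3])

lemma reduced_shift {l : List (ℤ × D)} (hl : R.Reduced l) (k : ℤ) :
    R.Reduced (R.shift l k).1 := by
  induction l generalizing k with
  | nil => exact hl
  | cons x l ih =>
    have hl' := hl
    obtain ⟨-, h2, h3⟩ := hl
    exact ⟨⟨Int.emod_nonneg _ (R.label_ne_zero _), Int.emod_lt_abs _ (R.label_ne_zero _)⟩,
      R.head_shift_ne h3 h2 _, ih h3 _⟩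

/-- The normal forms `a ^ c₁ t_{d₁} ⋯ a ^ cᵣ t_{dᵣ} a ^ m`. -/
abbrev NormalForm : Type := {l : List (ℤ × D) // R.Reduced l} × ℤ

/-- The normal form of the neutral element. -/
def one : R.NormalForm := (⟨[], trivial⟩, 0)

/-- Left multiplication by `a ^ k`, as a permutation of the normal forms. -/
def basePerm (k : ℤ) : Equiv.Perm R.NormalForm where
  toFun x := (⟨(R.shift x.1.1 k).1, R.reduced_shift x.1.2 k⟩, (R.shift x.1.1 k).2 + x.2)
  invFun x := (⟨(R.shift x.1.1 (-k)).1, R.reduced_shift x.1.2 (-k)⟩,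
    (R.shift x.1.1 (-k)).2 + x.2)
  left_inv x := by
    have h := R.shift_add x.1.1 (-k) k
    rw [neg_add_cancel, R.shift_zero x.1.2, Prod.mk.injEq] at h
    refine Prod.ext (Subtype.ext h.1.symm) ?_
    change _ + (_ + _) = _
    rw [← add_assoc, ← h.2, zero_add]
  right_inv x := by
    have h := R.shift_add x.1.1 k (-k)
    rw [add_neg_cancel, R.shift_zero x.1.2, Prod.mk.injEq] at h
    refine Prod.ext (Subtype.ext h.1.symm) ?_
    change _ + (_ + _) = _
    rw [← add_assoc, ← h.2, zero_add]

lemma basePerm_zpow (k : ℤ) : R.basePerm 1 ^ k = R.basePerm k := by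
  let f : Multiplicative ℤ →* Equiv.Perm R.NormalForm :=
    MonoidHom.mk' (fun k => R.basePerm k.toAdd) fun j k => by
      ext1 x
      have h := R.shift_add x.1.1 j.toAdd k.toAdd
      rw [Prod.ext_iff] at h
      refine Prod.ext (Subtype.ext h.1) ?_
      change (R.shift x.1.1 (j.toAdd + k.toAdd)).2 + x.2 = _ + (_ + _)
      rw [← add_assoc]
      exact congrArg (· + x.2) h.2
  have h := map_zpow f (Multiplicative.ofAdd 1) k
  rw [← ofAdd_zsmul, smul_eq_mul, mul_one] at h
  exact h.symm

open Classical in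
/-- Left multiplication by `t_d` on reduced words. -/
noncomputable def push (d : D) (l : List (ℤ × D)) : List (ℤ × D) :=
  if l.head? = some (0, R.rev d) then l.tail else (0, d) :: l

lemma push_of_ne {d : D} {l : List (ℤ × D)} (h : l.head? ≠ some (0, R.rev d)) :
    R.push d l = (0, d) :: l := by
  rw [push, if_neg h]

@[simp] lemma push_cons (d : D) (l : List (ℤ × D)) :
    R.push d ((0, R.rev d) :: l) = l := by
  simp [push]

lemma exists_or_push (d : D) {l : List (ℤ × D)} (hl : R.Reduced l) :
    (∃ l', R.Reduced l' ∧ l = (0, R.rev d) :: l' ∧ l'.head? ≠ some (0, d) ∧ R.push d l = l') ∨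
      (l.head? ≠ some (0, R.rev d) ∧ R.push d l = (0, d) :: l) := by
  by_cases h : l.head? = some (0, R.rev d)
  · left
    obtain ⟨l', rfl⟩ := List.head?_eq_some_iff.1 h
    refine ⟨l', hl.2.2, rfl, ?_, by simp⟩
    have := hl.2.1
    rwa [R.rev_rev] at this
  · exact Or.inr ⟨h, R.push_of_ne h⟩

lemma reduced_push (d : D) {l : List (ℤ × D)} (hl : R.Reduced l) : R.Reduced (R.push d l) := by
  rcases R.exists_or_push d hl with ⟨l', h1, -, -, h2⟩ | ⟨h1, h2⟩
  · rwa [h2]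
  · rw [h2]
    exact ⟨⟨le_rfl, abs_pos.2 (R.label_ne_zero _)⟩, h1, hl⟩

lemma push_rev_push (d : D) {l : List (ℤ × D)} (hl : R.Reduced l) :
    R.push (R.rev d) (R.push d l) = l := by
  rcases R.exists_or_push d hl with ⟨l', -, h2, h3, h4⟩ | ⟨h1, h2⟩
  · rw [h4, h2, R.push_of_ne (by rwa [R.rev_rev])]
  · have := R.push_cons (R.rev d) l
    rwa [R.rev_rev, ← h2] at this

/-- Left multiplication by `t_d`, as a permutation of the normal forms. -/
noncomputable def letterPerm (d : D) : Equiv.Perm R.NormalForm where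
  toFun x := (⟨R.push d x.1.1, R.reduced_push d x.1.2⟩, x.2)
  invFun x := (⟨R.push (R.rev d) x.1.1, R.reduced_push _ x.1.2⟩, x.2)
  left_inv x := Prod.ext (Subtype.ext (R.push_rev_push d x.1.2)) rfl
  right_inv x := by
    have := R.push_rev_push (R.rev d) x.1.2
    rw [R.rev_rev] at this
    exact Prod.ext (Subtype.ext this) rfl

lemma letterPerm_rev (d : D) : R.letterPerm (R.rev d) = (R.letterPerm d)⁻¹ := by
  ext1 x
  rfl

lemma basePerm_mul_letterPerm (d : D) : R.basePerm 1 ^ R.label d * R.letterPerm d =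
    R.letterPerm d * R.basePerm 1 ^ R.label (R.rev d) := by
  rw [basePerm_zpow, basePerm_zpow]
  ext1 x
  have hs : ∀ {d} {l : List (ℤ × D)}, R.shift ((0, d) :: l) (R.label d) =
      ((0, d) :: (R.shift l (R.label (R.rev d))).1, (R.shift l (R.label (R.rev d))).2) := by
    intro d l
    simp [shift_cons, Int.ediv_self (R.label_ne_zero d)]
  suffices h : R.shift (R.push d x.1.1) (R.label d) =
      (R.push d (R.shift x.1.1 (R.label (R.rev d))).1, (R.shift x.1.1 (R.label (R.rev d))).2) by
    rw [Prod.ext_iff] at h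
    exact Prod.ext (Subtype.ext h.1) (congrArg (· + x.2) h.2)
  rcases R.exists_or_push d x.1.2 with ⟨l', -, h2, h3, h4⟩ | ⟨h1, h2⟩
  · rw [h4, h2, hs, push_cons, R.rev_rev]
  · rw [h2, hs, R.push_of_ne]
    have := R.head_shift_ne x.1.2 h1 1
    rwa [one_mul] at this

/-! ### Evaluation of normal forms -/

section Evaluation

variable {V P : Type*} [Group P] (o : D → V) (α : V → P) (θ : D → P)

/-- A word is a path starting at `v`, if the letter `d` is an edge from `o d` to `o (rev d)`. -/
def IsPath : V → List (ℤ × D) → Prop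
  | _, [] => True
  | v, x :: l => o x.2 = v ∧ IsPath (o (R.rev x.2)) l

/-- The value of a normal form, read as a path starting at `v`, when `a` is evaluated as `α u` at
the vertex `u` and `t_d` as `θ d`. -/
def eval : V → List (ℤ × D) → ℤ → P
  | v, [], m => α v ^ m
  | v, x :: l, m => α v ^ x.1 * θ x.2 * eval (o (R.rev x.2)) l m

lemma isPath_shift (v : V) (l : List (ℤ × D)) (k : ℤ) :
    R.IsPath o v (R.shift l k).1 ↔ R.IsPath o v l := by
  induction l generalizing v k with
  | nil => exact Iff.rfl
  | cons x l ih => exact and_congr Iff.rfl (ih _ _)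

lemma eval_shift (hα : ∀ d, α (o d) ^ R.label d * θ d = θ d * α (o (R.rev d)) ^ R.label (R.rev d))
    {v : V} {l : List (ℤ × D)} (hl : R.IsPath o v l) (k m : ℤ) :
    R.eval o α θ v (R.shift l k).1 ((R.shift l k).2 + m) = α v ^ k * R.eval o α θ v l m := by
  have hα' : ∀ d (j : ℤ), α (o d) ^ (R.label d * j) * θ d =
      θ d * α (o (R.rev d)) ^ (j * R.label (R.rev d)) := by
    intro d j
    rw [mul_comm j, zpow_mul, zpow_mul]
    exact ((SemiconjBy.zpow_right (show SemiconjBy (θ d) _ _ from (hα d).symm) j)).symm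
  induction l generalizing v k with
  | nil => exact zpow_add _ _ _
  | cons x l ih =>
    obtain ⟨rfl, h⟩ := hl
    rw [shift_cons]
    simp only [eval]
    rw [ih h, ← mul_assoc, mul_assoc _ (θ x.2), ← hα', ← mul_assoc, ← zpow_add,
      Int.emod_add_mul_ediv, add_comm x.1, zpow_add, mul_assoc (_ ^ k), mul_assoc (_ ^ k)]

lemma isPath_push {d : D} {l : List (ℤ × D)} (hl : R.Reduced l) :
    R.IsPath o (o d) (R.push d l) ↔ R.IsPath o (o (R.rev d)) l := by
  rcases R.exists_or_push d hl with ⟨l', -, h2, -, h4⟩ | ⟨-, h2⟩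
  · rw [h4, h2]
    simp [IsPath, R.rev_rev]
  · rw [h2]
    simp [IsPath]

lemma eval_push (hθ : ∀ d, θ (R.rev d) = (θ d)⁻¹) {d : D} {l : List (ℤ × D)} (hl : R.Reduced l)
    (m : ℤ) : R.eval o α θ (o d) (R.push d l) m = θ d * R.eval o α θ (o (R.rev d)) l m := by
  rcases R.exists_or_push d hl with ⟨l', -, h2, -, h4⟩ | ⟨-, h2⟩
  · rw [h4, h2]
    simp [eval, R.rev_rev, hθ]
  · rw [h2]
    simp [eval]

/-- The permutation `μ` of the normal forms maps the paths starting at `v` to the paths starting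
at `u`, and multiplies their values by `g` on the left. -/
def Realizes (u v : V) (g : P) (μ : Equiv.Perm R.NormalForm) : Prop :=
  ∀ x : R.NormalForm, (R.IsPath o v x.1.1 ↔ R.IsPath o u (μ x).1.1) ∧
    (R.IsPath o v x.1.1 →
      R.eval o α θ u (μ x).1.1 (μ x).2 = g * R.eval o α θ v x.1.1 x.2)

variable {R o α θ}

lemma Realizes.one (v : V) : R.Realizes o α θ v v 1 1 := fun x => ⟨Iff.rfl, fun _ => by simp⟩

lemma Realizes.mul {u v w : V} {g h : P} {μ ν : Equiv.Perm R.NormalForm}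
    (H : R.Realizes o α θ u v g μ) (H' : R.Realizes o α θ v w h ν) :
    R.Realizes o α θ u w (g * h) (μ * ν) := by
  intro x
  refine ⟨(H' x).1.trans (H (ν x)).1, fun hx => ?_⟩
  rw [Equiv.Perm.mul_apply, (H (ν x)).2 ((H' x).1.1 hx), (H' x).2 hx, mul_assoc]

lemma Realizes.inv {u v : V} {g : P} {μ : Equiv.Perm R.NormalForm}
    (H : R.Realizes o α θ u v g μ) : R.Realizes o α θ v u g⁻¹ μ⁻¹ := by
  intro x
  have h := H (μ⁻¹ x)
  rw [← Equiv.Perm.mul_apply, mul_inv_cancel, Equiv.Perm.one_apply] at h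
  exact ⟨h.1.symm, fun hx => by rw [h.2 (h.1.2 hx), inv_mul_cancel_left]⟩

lemma realizes_basePerm
    (hα : ∀ d, α (o d) ^ R.label d * θ d = θ d * α (o (R.rev d)) ^ R.label (R.rev d)) (v : V) :
    R.Realizes o α θ v v (α v) (R.basePerm 1) := by
  intro x
  refine ⟨(R.isPath_shift o v _ _).symm, fun hx => ?_⟩
  have := R.eval_shift o α θ hα hx 1 x.2
  rwa [zpow_one] at this

lemma realizes_letterPerm (hθ : ∀ d, θ (R.rev d) = (θ d)⁻¹) (d : D) :
    R.Realizes o α θ (o d) (o (R.rev d)) (θ d) (R.letterPerm d) :=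
  fun x => ⟨(R.isPath_push o x.1.2).symm, fun _ => R.eval_push o α θ hθ x.1.2 x.2⟩

lemma Realizes.eq_one {v : V} {g : P} (H : R.Realizes o α θ v v g 1) : g = 1 := by
  have := (H R.one).2 trivial
  simpa [LabelledRose.one, eval] using this.symm

end Evaluation

/-! ### The multiple HNN extension and its tree -/

/-- The group `⟨a, t_d | t_{rev d} = t_d⁻¹, t_d⁻¹ a ^ label d t_d = a ^ label (rev d)⟩`, realized
as a group of permutations of the normal forms. -/
def group : Subgroup (Equiv.Perm R.NormalForm) :=
  Subgroup.closure (insert (R.basePerm 1) (Set.range R.letterPerm))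

/-- The generator `a`. -/
def base : R.group := ⟨R.basePerm 1, Subgroup.subset_closure (Set.mem_insert _ _)⟩

/-- The generator `t_d`. -/
noncomputable def letter (d : D) : R.group :=
  ⟨R.letterPerm d, Subgroup.subset_closure (Set.mem_insert_of_mem _ ⟨d, rfl⟩)⟩

lemma letter_rev (d : D) : R.letter (R.rev d) = (R.letter d)⁻¹ := Subtype.ext (R.letterPerm_rev d)

lemma base_mul_letter (d : D) : R.base ^ R.label d * R.letter d =
    R.letter d * R.base ^ R.label (R.rev d) := Subtype.ext (R.basePerm_mul_letterPerm d)

lemma group_induction {p : R.group → Prop} (hbase : p R.base) (hletter : ∀ d, p (R.letter d))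
    (hone : p 1) (hmul : ∀ m m', p m → p m' → p (m * m')) (hinv : ∀ m, p m → p m⁻¹)
    (m : R.group) : p m := by
  obtain ⟨m, hm⟩ := m
  induction hm using Subgroup.closure_induction with
  | mem x hx =>
    rcases hx with rfl | ⟨d, rfl⟩
    · exact hbase
    · exact hletter d
  | one => exact hone
  | mul x y hx hy h1 h2 => exact hmul ⟨x, hx⟩ ⟨y, hy⟩ h1 h2
  | inv x hx h => exact hinv ⟨x, hx⟩ h

lemma realizes_self (m : R.group) :
    R.Realizes (fun _ => ()) (fun _ => R.base) R.letter () () m (m : Equiv.Perm R.NormalForm) := by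
  induction m using R.group_induction with
  | hbase => exact realizes_basePerm (o := fun _ => ()) R.base_mul_letter ()
  | hletter d => exact realizes_letterPerm (o := fun _ => ()) R.letter_rev d
  | hone => exact Realizes.one _
  | hmul m m' h h' => exact h.mul h'
  | hinv m h => exact h.inv

/-- The reduced word of an element, without the final power of `a`. -/
def word (m : R.group) : List (ℤ × D) := ((m : Equiv.Perm R.NormalForm) R.one).1.1

lemma eq_eval (m : R.group) : m = R.eval (fun _ => ()) (fun _ => R.base) R.letter () (R.word m)
    ((m : Equiv.Perm R.NormalForm) R.one).2 := by
  have h := (R.realizes_self m R.one).2 trivial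
  rw [word, h]
  simp [eval, one]

lemma eval_mul_zpow (l : List (ℤ × D)) (k j : ℤ) :
    R.eval (fun _ => ()) (fun _ => R.base) R.letter () l (k + j) =
      R.eval (fun _ => ()) (fun _ => R.base) R.letter () l k * R.base ^ j := by
  induction l with
  | nil => exact zpow_add _ _ _
  | cons x l ih => simp only [eval, ih, mul_assoc]

lemma mem_zpowers_of_word_eq {m m' : R.group} (h : R.word m = R.word m') :
    m⁻¹ * m' ∈ Subgroup.zpowers R.base := by
  rw [R.eq_eval m', R.eq_eval m, ← h]
  set j := ((m : Equiv.Perm R.NormalForm) R.one).2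
  set k := ((m' : Equiv.Perm R.NormalForm) R.one).2
  refine ⟨k - j, ?_⟩
  rw [← add_sub_cancel j k, eval_mul_zpow]
  simp

lemma base_zpow_apply_one (k : ℤ) :
    ((R.base ^ k : R.group) : Equiv.Perm R.NormalForm) R.one = (⟨[], trivial⟩, k) := by
  rw [Subgroup.coe_zpow]
  change (R.basePerm 1 ^ k) R.one = _
  rw [basePerm_zpow]
  simp [basePerm, one]

lemma base_zpow_eq_one {k : ℤ} (h : R.base ^ k = 1) : k = 0 := by
  have := R.base_zpow_apply_one k
  rw [h] at this
  exact (congrArg Prod.snd this).symm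

/-- Two words are neighbours in the tree of reduced words. -/
def Extends (l l' : List (ℤ × D)) : Prop := (∃ z, l' = l ++ [z]) ∨ ∃ z, l = l' ++ [z]

lemma shift_append (l : List (ℤ × D)) (z : ℤ × D) (k : ℤ) :
    ∃ z', (R.shift (l ++ [z]) k).1 = (R.shift l k).1 ++ [z'] := by
  induction l generalizing k with
  | nil => exact ⟨_, rfl⟩
  | cons x l ih =>
    obtain ⟨z', hz'⟩ := ih ((x.1 + k) / R.label x.2 * R.label (R.rev x.2))
    exact ⟨z', by rw [List.cons_append, shift_cons, hz']; rfl⟩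

lemma extends_push (d : D) (l : List (ℤ × D)) (z : ℤ × D) :
    Extends (R.push d l) (R.push d (l ++ [z])) := by
  cases l with
  | nil =>
    by_cases h : z = (0, R.rev d)
    · subst h
      right
      exact ⟨(0, d), by simp [push]⟩
    · left
      exact ⟨z, by simp [push, h]⟩
  | cons x l =>
    left
    refine ⟨z, ?_⟩
    by_cases h : x = (0, R.rev d) <;> simp [push, h]

lemma Extends.symm {l l' : List (ℤ × D)} (h : Extends l l') : Extends l' l := Or.symm h

lemma Extends.shift {l l' : List (ℤ × D)} (h : Extends l l') (k : ℤ) :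
    Extends (R.shift l k).1 (R.shift l' k).1 := by
  rcases h with ⟨z, rfl⟩ | ⟨z, rfl⟩
  · exact Or.inl (R.shift_append l z k)
  · exact Or.inr (R.shift_append l' z k)

lemma Extends.push {l l' : List (ℤ × D)} (h : Extends l l') (d : D) :
    Extends (R.push d l) (R.push d l') := by
  rcases h with ⟨z, rfl⟩ | ⟨z, rfl⟩
  · exact R.extends_push d l z
  · exact (R.extends_push d l' z).symm

lemma extends_apply (m : R.group) (x y : R.NormalForm) :
    Extends (((m : Equiv.Perm R.NormalForm) x).1.1) (((m : Equiv.Perm R.NormalForm) y).1.1) ↔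
      Extends x.1.1 y.1.1 := by
  induction m using R.group_induction generalizing x y with
  | hbase =>
    refine ⟨fun h => ?_, fun h => h.shift R 1⟩
    have h2 : ∀ x : R.NormalForm, R.basePerm (-1) (R.basePerm 1 x) = x := by
      intro x
      rw [← basePerm_zpow, zpow_neg_one, ← Equiv.Perm.mul_apply, inv_mul_cancel,
        Equiv.Perm.one_apply]
    rw [← h2 x, ← h2 y]
    exact Extends.shift R h (-1)
  | hletter d =>
    refine ⟨fun h => ?_, fun h => h.push R d⟩
    rw [← R.push_rev_push d x.1.2, ← R.push_rev_push d y.1.2]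
    exact Extends.push R h (R.rev d)
  | hone => exact Iff.rfl
  | hmul m m' h h' => exact (h _ _).trans (h' x y)
  | hinv m h =>
    rw [← h]
    simp only [Subgroup.coe_inv, ← Equiv.Perm.mul_apply, mul_inv_cancel, Equiv.Perm.one_apply]

lemma apply_add (m : R.group) (x : R.NormalForm) (k : ℤ) :
    (m : Equiv.Perm R.NormalForm) (x.1, x.2 + k) =
      (((m : Equiv.Perm R.NormalForm) x).1, ((m : Equiv.Perm R.NormalForm) x).2 + k) := by
  induction m using R.group_induction generalizing x k with
  | hbase => exact Prod.ext rfl (add_assoc _ _ _).symm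
  | hletter d => rfl
  | hone => rfl
  | hmul m m' h h' =>
    simp only [Subgroup.coe_mul, Equiv.Perm.mul_apply]
    rw [h', h]
  | hinv m h =>
    rw [Subgroup.coe_inv, Equiv.Perm.inv_eq_iff_eq, h, ← Equiv.Perm.mul_apply, mul_inv_cancel,
      Equiv.Perm.one_apply]

lemma word_mul_base_zpow (m : R.group) (k : ℤ) : R.word (m * R.base ^ k) = R.word m := by
  have h := R.apply_add m R.one k
  have h1 := R.base_zpow_apply_one k
  rw [word, word, Subgroup.coe_mul, Equiv.Perm.mul_apply, h1]
  rw [show ((⟨[], trivial⟩, k) : R.NormalForm) = (R.one.1, R.one.2 + k) by simp [one], h]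

lemma extends_word_mul_letter (m : R.group) (d : D) :
    Extends (R.word m) (R.word (m * R.letter d)) := by
  rw [word, word, Subgroup.coe_mul, Equiv.Perm.mul_apply, extends_apply]
  exact Or.inl ⟨(0, d), by simp [letter, letterPerm, one, push]⟩

/-- The vertices of the Bass-Serre tree. -/
abbrev Vertex : Type := R.group ⧸ Subgroup.zpowers R.base

/-- The reduced word of a vertex, which describes the path to it from the base vertex. -/
def vertexWord : R.Vertex → List (ℤ × D) :=
  Quotient.lift R.word fun m m' h => by
    obtain ⟨k, hk⟩ := QuotientGroup.leftRel_apply.1 h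
    rw [← mul_inv_cancel_left m m', ← hk]
    exact (R.word_mul_base_zpow m k).symm

lemma vertexWord_injective : Function.Injective R.vertexWord := by
  intro x y
  induction x using QuotientGroup.induction_on
  induction y using QuotientGroup.induction_on
  intro h
  exact QuotientGroup.eq.2 (R.mem_zpowers_of_word_eq h)

/-- Adjacency in the Bass-Serre tree. -/
def TreeAdj (x y : R.Vertex) : Prop :=
  ∃ (m : R.group) (d : D), x = QuotientGroup.mk m ∧ y = QuotientGroup.mk (m * R.letter d)

lemma TreeAdj.symm {x y : R.Vertex} (h : R.TreeAdj x y) : R.TreeAdj y x := by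
  obtain ⟨m, d, rfl, rfl⟩ := h
  exact ⟨m * R.letter d, R.rev d, rfl, by rw [letter_rev, mul_inv_cancel_right]⟩

lemma TreeAdj.smul {x y : R.Vertex} (h : R.TreeAdj x y) (g : R.group) :
    R.TreeAdj (g • x) (g • y) := by
  obtain ⟨m, d, rfl, rfl⟩ := h
  exact ⟨g * m, d, rfl, by rw [mul_assoc]; rfl⟩

lemma TreeAdj.extends {x y : R.Vertex} (h : R.TreeAdj x y) :
    Extends (R.vertexWord x) (R.vertexWord y) := by
  obtain ⟨m, d, rfl, rfl⟩ := h
  exact R.extends_word_mul_letter m d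

lemma reflTransGen_treeAdj (x y : R.Vertex) : Relation.ReflTransGen R.TreeAdj x y := by
  have hsymm : ∀ {x y}, Relation.ReflTransGen R.TreeAdj x y →
      Relation.ReflTransGen R.TreeAdj y x := by
    intro x y h
    induction h with
    | refl => exact Relation.ReflTransGen.refl
    | tail _ h ih => exact ih.head (TreeAdj.symm R h)
  have hsmul : ∀ (g : R.group) {x y}, Relation.ReflTransGen R.TreeAdj x y →
      Relation.ReflTransGen R.TreeAdj (g • x) (g • y) := by
    intro g x y h
    induction h with
    | refl => exact Relation.ReflTransGen.refl
    | tail _ h ih => exact ih.tail (TreeAdj.smul R h g)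
  let x₀ : R.Vertex := QuotientGroup.mk 1
  have key : ∀ m : R.group, Relation.ReflTransGen R.TreeAdj x₀ (m • x₀) := by
    intro m
    induction m using R.group_induction with
    | hbase =>
      rw [show R.base • x₀ = x₀ from (QuotientGroup.eq.2 (by simp))]
    | hletter d =>
      refine Relation.ReflTransGen.single ⟨1, d, rfl, ?_⟩
      rw [one_mul, show R.letter d • x₀ = QuotientGroup.mk (R.letter d * 1) from rfl, mul_one]
    | hone => rw [one_smul]
    | hmul m m' h h' =>
      rw [mul_smul]
      exact h.trans (hsmul m h')
    | hinv m h =>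
      have := hsmul m⁻¹ h
      rw [inv_smul_smul] at this
      exact hsymm this
  have key' : ∀ x, Relation.ReflTransGen R.TreeAdj x₀ x := by
    intro x
    induction x using QuotientGroup.induction_on with
    | H m =>
      have := key m
      rwa [show m • x₀ = QuotientGroup.mk (m * 1) from rfl, mul_one] at this
  exact (hsymm (key' x)).trans (key' y)

open Classical in
/-- In the tree of words, the neighbour of `l` in the direction of `l'`. -/
noncomputable def wordDir (l l' : List (ℤ × D)) : List (ℤ × D) :=
  if l <+: l' then l'.take (l.length + 1) else l.dropLast

lemma wordDir_of_extends {l l' : List (ℤ × D)} (h : Extends l l') : wordDir l l' = l' := by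
  rcases h with ⟨z, rfl⟩ | ⟨z, rfl⟩
  · rw [wordDir, if_pos (List.prefix_append _ _), List.take_of_length_le (by simp)]
  · rw [wordDir, if_neg, List.dropLast_concat]
    intro h
    simpa using h.length_le

lemma wordDir_append {l l' : List (ℤ × D)} {z : ℤ × D} (h : l' ≠ l) (h' : l' ++ [z] ≠ l) :
    wordDir l l' = wordDir l (l' ++ [z]) := by
  rw [wordDir, wordDir]
  have hiff : l <+: l' ++ [z] ↔ l <+: l' := by
    rw [List.prefix_concat_iff]
    exact or_iff_right (Ne.symm h')
  by_cases hl : l <+: l'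
  · rw [if_pos hl, if_pos (hiff.2 hl), List.take_append_of_le_length]
    exact lt_of_le_of_ne hl.length_le fun e => h (hl.eq_of_length e).symm
  · rw [if_neg hl, if_neg (by rwa [hiff])]

lemma wordDir_congr {l w w' : List (ℤ × D)} (h : Extends w w') (hw : w ≠ l) (hw' : w' ≠ l) :
    wordDir l w = wordDir l w' := by
  rcases h with ⟨z, rfl⟩ | ⟨z, rfl⟩
  · exact wordDir_append hw hw'
  · exact (wordDir_append hw' hw).symm

open Classical in
/-- The Bass-Serre tree: the vertices are the cosets of `⟨a⟩`, and `m⟨a⟩` is adjacent to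
`m t_d ⟨a⟩`. -/
noncomputable def tree : DirectedTree R.Vertex where
  Adj := R.TreeAdj
  symm h := TreeAdj.symm R h
  ne h e := by
    subst e
    rcases TreeAdj.extends R h with ⟨z, hz⟩ | ⟨z, hz⟩ <;> simp at hz
  conn := R.reflTransGen_treeAdj
  dir x w := if h : ∃ y, R.vertexWord y = wordDir (R.vertexWord x) (R.vertexWord w) then h.choose
    else x
  dir_of_adj := by
    intro x y h
    have hex : ∃ y', R.vertexWord y' = wordDir (R.vertexWord x) (R.vertexWord y) :=
      ⟨y, (wordDir_of_extends (TreeAdj.extends R h)).symm⟩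
    rw [dif_pos hex]
    apply R.vertexWord_injective
    rw [hex.choose_spec, wordDir_of_extends (TreeAdj.extends R h)]
  dir_congr := by
    intro x w w' h hw hw'
    rw [wordDir_congr (TreeAdj.extends R h) (R.vertexWord_injective.ne hw)
      (R.vertexWord_injective.ne hw')]

lemma exists_eq_conj_of_smul_eq {m g : R.group} (h : g • (QuotientGroup.mk m : R.Vertex) =
    QuotientGroup.mk m) : ∃ k : ℤ, g = m * R.base ^ k * m⁻¹ := by
  obtain ⟨k, hk⟩ := QuotientGroup.eq.1 h.symm
  refine ⟨k, ?_⟩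
  dsimp only at hk
  rw [hk]
  simp [mul_assoc]

/-- Every element of the group commensurates `⟨a⟩`. -/
lemma exists_base_zpow_conj (m : R.group) :
    ∃ i j : ℤ, i ≠ 0 ∧ j ≠ 0 ∧ m * R.base ^ i * m⁻¹ = R.base ^ j := by
  induction m using R.group_induction with
  | hbase => exact ⟨1, 1, one_ne_zero, one_ne_zero, by simp⟩
  | hletter d =>
    refine ⟨R.label (R.rev d), R.label d, R.label_ne_zero _, R.label_ne_zero _, ?_⟩
    rw [← base_mul_letter, mul_inv_cancel_right]
  | hone => exact ⟨1, 1, one_ne_zero, one_ne_zero, by simp⟩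
  | hmul m m' h h' =>
    obtain ⟨i, j, hi, hj, h⟩ := h
    obtain ⟨i', j', hi', hj', h'⟩ := h'
    refine ⟨i' * i, j * j', mul_ne_zero hi' hi, mul_ne_zero hj hj', ?_⟩
    have e1 : m' * R.base ^ (i' * i) * m'⁻¹ = R.base ^ (j' * i) := by
      rw [zpow_mul, ← conj_zpow, h', zpow_mul]
    have e2 : m * R.base ^ (j' * i) * m⁻¹ = R.base ^ (j * j') := by
      rw [mul_comm j' i, zpow_mul, ← conj_zpow, h, zpow_mul]
    rw [← e2, ← e1]
    group
  | hinv m h =>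
    obtain ⟨i, j, hi, hj, h⟩ := h
    refine ⟨j, i, hj, hi, ?_⟩
    rw [← h]
    group

end LabelledRose

/-! ### Presentations of GBS groups -/

/-- The standard presentation of a GBS group: a generator `a v` for each vertex, a stable letter
`t e` for each edge, the relations `t_e⁻¹ a_{src e} ^ p_e t_e = a_{tgt e} ^ q_e`, and `t_e = 1` for
`e` in a spanning tree. The universal property is only required for targets in `Type`. -/
structure GBSPresentation (G : Type*) [Group G] (V E : Type) where
  src : E → V
  tgt : E → V
  p : E → ℤ
  q : E → ℤ
  p_ne_zero : ∀ e, p e ≠ 0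
  q_ne_zero : ∀ e, q e ≠ 0
  a : V → G
  t : E → G
  tree : Set E
  rel : ∀ e, (t e)⁻¹ * a (src e) ^ p e * t e = a (tgt e) ^ q e
  t_eq_one : ∀ e ∈ tree, t e = 1
  closure_eq_top : Subgroup.closure (Set.range a ∪ Set.range t) = ⊤
  exists_lift : ∀ {P : Type} [Group P] (α : V → P) (θ : E → P),
    (∀ e, (θ e)⁻¹ * α (src e) ^ p e * θ e = α (tgt e) ^ q e) → (∀ e ∈ tree, θ e = 1) →
    ∃ f : G →* P, (∀ v, f (a v) = α v) ∧ ∀ e, f (t e) = θ e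
  spans : ∀ u v : V, Relation.EqvGen (fun x y => ∃ e ∈ tree, src e = x ∧ tgt e = y) u v
  minimal : ∀ e ∈ tree,
    ¬ ∀ u v : V, Relation.EqvGen (fun x y => ∃ e' ∈ tree \ {e}, src e' = x ∧ tgt e' = y) u v

namespace GraphOfGroups

variable {V E : Type} (Γ : GraphOfGroups.{0, 0, 0} V E)

lemma exists_zpow_generator {A B : Type*} [Group A] [Group B] (i : A ≃* Multiplicative ℤ)
    (j : B ≃* Multiplicative ℤ) {f : A →* B} (hf : Function.Injective f) :
    ∃ p : ℤ, p ≠ 0 ∧ f (i.symm (Multiplicative.ofAdd 1)) = j.symm (Multiplicative.ofAdd 1) ^ p := by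
  refine ⟨(j (f (i.symm (Multiplicative.ofAdd 1)))).toAdd, fun h => ?_, ?_⟩
  · have h1 : i.symm (Multiplicative.ofAdd (1 : ℤ)) = 1 := by
      apply hf
      apply j.injective
      rw [map_one f, map_one j]
      exact h
    rw [EmbeddingLike.map_eq_one_iff, ofAdd_eq_one] at h1
    exact one_ne_zero h1
  · apply j.injective
    rw [map_zpow, MulEquiv.apply_symm_apply, ← ofAdd_zsmul, smul_eq_mul, mul_one, ofAdd_toAdd]

lemma eq_zpow_generator {A : Type*} [Group A] (i : A ≃* Multiplicative ℤ) (x : A) :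
    x = i.symm (Multiplicative.ofAdd 1) ^ (i x).toAdd := by
  apply i.injective
  rw [map_zpow, MulEquiv.apply_symm_apply, ← ofAdd_zsmul, smul_eq_mul, mul_one, ofAdd_toAdd]

lemma closure_vert_letter (i : ∀ v, Γ.vertexGroup v ≃* Multiplicative ℤ) :
    Subgroup.closure (Set.range (fun v => Γ.vert v ((i v).symm (Multiplicative.ofAdd 1))) ∪
      Set.range Γ.letter) = ⊤ := by
  set H := Subgroup.closure (Set.range (fun v => Γ.vert v ((i v).symm (Multiplicative.ofAdd 1))) ∪
      Set.range Γ.letter) with hH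
  rw [eq_top_iff, ← Monoid.Coprod.range_inl_sup_range_inr, sup_le_iff]
  constructor
  · rintro _ ⟨x, rfl⟩
    induction x using Monoid.CoprodI.induction_on with
    | one => rw [map_one]; exact one_mem H
    | of v x =>
      rw [eq_zpow_generator (i v) x, map_zpow, map_zpow]
      exact zpow_mem (K := H) (Subgroup.subset_closure (Or.inl ⟨v, rfl⟩)) _
    | mul x y hx hy => rw [map_mul]; exact mul_mem hx hy
  · rintro _ ⟨x, rfl⟩
    induction x using FreeGroup.induction_on with
    | C1 => rw [map_one]; exact one_mem H
    | of e => exact Subgroup.subset_closure (Or.inr ⟨e, rfl⟩)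
    | inv_of e h => rw [map_inv]; exact inv_mem h
    | mul x y hx hy => rw [map_mul]; exact mul_mem hx hy

end GraphOfGroups

open GraphOfGroups in
lemma IsGBS.exists_presentation {G : Type*} [Group G] (hG : IsGBS G) :
    ∃ (V E : Type) (_ : Finite V) (_ : Finite E) (_ : Nonempty V),
      Nonempty (GBSPresentation G V E) := by
  obtain ⟨V, E, hV, hE, Γ, T, hT, hv, he, ⟨φ⟩⟩ := hG
  refine ⟨V, E, hV, hE, Γ.nonempty, ?_⟩
  let i := fun v => (hv v).some
  let j := fun e => (he e).some
  choose p hp hp' using fun e => exists_zpow_generator (j e) (i (Γ.src e)) (Γ.inclSrc_injective e)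
  choose q hq hq' using fun e => exists_zpow_generator (j e) (i (Γ.tgt e)) (Γ.inclTgt_injective e)
  let gen : ∀ v, Γ.vertexGroup v := fun v => (i v).symm (Multiplicative.ofAdd 1)
  let π : Γ.FreeProd →* Γ.FundamentalGroup T := QuotientGroup.mk' _
  let ψ : Γ.FreeProd →* G := φ.symm.toMonoidHom.comp π
  have hψ : Function.Surjective ψ :=
    φ.symm.surjective.comp (QuotientGroup.mk'_surjective _)
  have hrel : ∀ r ∈ Γ.relators T, ψ r = 1 := by
    intro r hr
    have : π r = 1 := (QuotientGroup.eq_one_iff r).2 (Subgroup.subset_normalClosure hr)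
    change φ.symm (π r) = 1
    rw [this, map_one]
  have hvert : ∀ v (k : ℤ), Γ.vert v (gen v ^ k) = Γ.vert v (gen v) ^ k := by
    intro v k
    simp only [vert, map_zpow]
  refine ⟨{ src := Γ.src, tgt := Γ.tgt, p := p, q := q, p_ne_zero := hp, q_ne_zero := hq,
            a := fun v => ψ (Γ.vert v (gen v)), t := fun e => ψ (Γ.letter e), tree := T,
            rel := ?_, t_eq_one := ?_, closure_eq_top := ?_, exists_lift := ?_,
            spans := hT.1, minimal := hT.2 }⟩
  · intro e
    have h := hrel _ (Or.inl ⟨e, (j e).symm (Multiplicative.ofAdd 1), rfl⟩)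
    rw [hp', hq', map_mul, map_inv, mul_inv_eq_one] at h
    have e1 := hvert (Γ.src e) (p e)
    have e2 := hvert (Γ.tgt e) (q e)
    simp only [gen] at e1 e2
    rw [e1, e2] at h
    simpa only [map_mul, map_inv, map_zpow] using h
  · exact fun e he => hrel _ (Or.inr ⟨e, he, rfl⟩)
  · have h := congrArg (Subgroup.map ψ) (Γ.closure_vert_letter i)
    rw [MonoidHom.map_closure, Subgroup.map_top_of_surjective ψ hψ, Set.image_union,
      ← Set.range_comp, ← Set.range_comp] at h
    exact h
  · intro P _ α θ h1 h2
    let f₀ : Γ.FreeProd →* P := Monoid.Coprod.lift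
      (Monoid.CoprodI.lift fun v => (zpowersHom P (α v)).comp (i v).toMonoidHom)
      (FreeGroup.lift θ)
    have hf₁ : ∀ v x, f₀ (Γ.vert v x) = α v ^ (i v x).toAdd := by
      intro v x
      simp [f₀, vert]
    have hf₂ : ∀ e, f₀ (Γ.letter e) = θ e := by
      intro e
      simp [f₀, letter]
    have hf₃ : ∀ r ∈ Γ.relators T, f₀ r = 1 := by
      rintro r (⟨e, x, rfl⟩ | ⟨e, he, rfl⟩)
      · rw [eq_zpow_generator (j e) x, map_zpow, map_zpow, hp', hq']
        simp only [map_mul, map_inv, hf₁, hf₂, map_zpow, MulEquiv.apply_symm_apply, toAdd_zpow,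
          toAdd_ofAdd, smul_eq_mul, mul_one]
        rw [mul_comm ((j e) x).toAdd, mul_comm ((j e) x).toAdd, zpow_mul, zpow_mul, ← h1,
          mul_inv_eq_one]
        simpa using (conj_zpow (i := (j e x).toAdd) (a := (θ e)⁻¹)
          (b := α (Γ.src e) ^ p e)).symm
      · rw [hf₂, h2 e he]
    let f₁ : Γ.FundamentalGroup T →* P := QuotientGroup.lift _ f₀
      (by
        exact Subgroup.normalClosure_le_normal hf₃)
    refine ⟨f₁.comp φ.toMonoidHom, fun v => ?_, fun e => ?_⟩
    · change f₁ (φ (φ.symm (π _))) = _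
      rw [MulEquiv.apply_symm_apply]
      refine (hf₁ v (gen v)).trans ?_
      rw [MulEquiv.apply_symm_apply, toAdd_ofAdd, zpow_one]
    · change f₁ (φ (φ.symm (π _))) = _
      rw [MulEquiv.apply_symm_apply]
      exact hf₂ e

namespace GBSPresentation

variable {G : Type*} [Group G] {V E : Type} (B : GBSPresentation G V E)

/-- On a tree every function on the edges with values in a group is a coboundary. -/
lemma exists_potential [Finite E] {P : Type*} [Group P] (θ : E → P) :
    ∃ τ : V → P, ∀ e ∈ B.tree, τ (B.src e) * θ e = τ (B.tgt e) := by
  classical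
  suffices h : ∀ s : Set E, s.Finite → s ⊆ B.tree →
      ∃ τ : V → P, ∀ e ∈ s, τ (B.src e) * θ e = τ (B.tgt e) from
    h B.tree (Set.toFinite _) subset_rfl
  intro s hs
  induction s, hs using Set.Finite.induction_on with
  | empty => exact fun _ => ⟨fun _ => 1, fun e he => absurd he (Set.notMem_empty e)⟩
  | @insert e s he _ ih =>
    intro hsub
    obtain ⟨τ, hτ⟩ := ih ((Set.subset_insert e s).trans hsub)
    let r : V → V → Prop := fun x y => ∃ e' ∈ s, B.src e' = x ∧ B.tgt e' = y
    -- otherwise `e` could be removed from the spanning tree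
    have hne : ¬ Relation.EqvGen r (B.src e) (B.tgt e) := by
      intro h
      refine B.minimal e (hsub (Set.mem_insert e s)) fun u v => ?_
      have hle : ∀ {x y}, Relation.EqvGen r x y → Relation.EqvGen
          (fun x y => ∃ e' ∈ B.tree \ {e}, B.src e' = x ∧ B.tgt e' = y) x y := by
        intro x y hxy
        refine Relation.EqvGen.mono ?_ _ _ hxy
        rintro x y ⟨e', he', h⟩
        refine ⟨e', ⟨hsub (Set.mem_insert_of_mem _ he'), ?_⟩, h⟩
        rintro rfl
        exact he he'
      induction B.spans u v with
      | rel x y hxy =>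
        obtain ⟨e', he', rfl, rfl⟩ := hxy
        by_cases hee : e' = e
        · subst hee; exact hle h
        · exact Relation.EqvGen.rel _ _ ⟨e', ⟨he', hee⟩, rfl, rfl⟩
      | refl x => exact Relation.EqvGen.refl x
      | symm x y _ ih => exact ih.symm
      | trans x y z _ _ ih ih' => exact ih.trans _ _ _ ih'
    -- correct `τ` on the component of the endpoint of `e`
    let g : P := τ (B.src e) * θ e * (τ (B.tgt e))⁻¹
    refine ⟨fun v => if Relation.EqvGen r v (B.tgt e) then g * τ v else τ v, fun e' he' => ?_⟩
    rcases he' with rfl | he'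
    · simp only [if_neg hne, if_pos (Relation.EqvGen.refl (B.tgt e')), g]
      group
    · have h1 : Relation.EqvGen r (B.src e') (B.tgt e') := Relation.EqvGen.rel _ _ ⟨e', he', rfl, rfl⟩
      by_cases h : Relation.EqvGen r (B.tgt e') (B.tgt e)
      · simp only [if_pos h, if_pos (h1.trans _ _ _ h), mul_assoc, hτ e' he']
      · have h' : ¬ Relation.EqvGen r (B.src e') (B.tgt e) := fun h' =>
          h (h1.symm.trans _ _ _ h')
        simp only [if_neg h, if_neg h', hτ e' he']

/-- The one-vertex graph obtained by identifying all the vertices. The oriented edge `(e, true)` is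
`e`, and `(e, false)` is its reverse. -/
def rose : LabelledRose (E × Bool) where
  rev d := (d.1, !d.2)
  rev_rev d := by simp
  label d := if d.2 then B.p d.1 else B.q d.1
  label_ne_zero d := by
    split_ifs
    · exact B.p_ne_zero _
    · exact B.q_ne_zero _

/-- The origin of an oriented edge. -/
def origin (d : E × Bool) : V := if d.2 then B.src d.1 else B.tgt d.1

/-- The stable letter of an oriented edge. -/
def orientedLetter (d : E × Bool) : G := if d.2 then B.t d.1 else (B.t d.1)⁻¹

lemma orientedLetter_rev (d : E × Bool) :
    B.orientedLetter (B.rose.rev d) = (B.orientedLetter d)⁻¹ := by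
  obtain ⟨e, _ | _⟩ := d <;> simp [orientedLetter, rose]

lemma a_mul_orientedLetter (d : E × Bool) :
    B.a (B.origin d) ^ B.rose.label d * B.orientedLetter d =
      B.orientedLetter d * B.a (B.origin (B.rose.rev d)) ^ B.rose.label (B.rose.rev d) := by
  obtain ⟨e, _ | _⟩ := d
  · simp only [origin, rose, orientedLetter, Bool.not_false, if_true, if_false,
      Bool.false_eq_true, ← B.rel e]
    group
  · simp only [origin, rose, orientedLetter, Bool.not_true, if_true, if_false,
      Bool.false_eq_true, ← B.rel e]
    group

/-- `μ` permutes normal forms the way `g` acts on paths from `v`, giving paths from `u`. -/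
abbrev Realizes (u v : V) (g : G) (m : B.rose.group) : Prop :=
  B.rose.Realizes B.origin B.a B.orientedLetter u v g m

/-- The group embeds in the one-vertex group of its rose, by an injective homomorphism mapping the
vertex groups into conjugates of the base. -/
lemma exists_embedding [Finite E] [Nonempty V] :
    ∃ ι : G →* B.rose.group, Function.Injective ι ∧
      ∀ v, ∃ τ : B.rose.group, ι (B.a v) = τ * B.rose.base * τ⁻¹ := by
  obtain ⟨τ, hτ⟩ := B.exists_potential fun e => B.rose.letter (e, true)
  obtain ⟨ι, hι₁, hι₂⟩ := B.exists_lift (fun v => τ v * B.rose.base * (τ v)⁻¹)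
    (fun e => τ (B.src e) * B.rose.letter (e, true) * (τ (B.tgt e))⁻¹)
    (fun e => by
      have h := B.rose.base_mul_letter (e, true)
      have hp : B.rose.label (e, true) = B.p e := rfl
      have hq : B.rose.label (B.rose.rev (e, true)) = B.q e := rfl
      rw [hp, hq] at h
      rw [conj_zpow, conj_zpow]
      calc _ = τ (B.tgt e) * (B.rose.letter (e, true))⁻¹ *
              (B.rose.base ^ B.p e * B.rose.letter (e, true)) * (τ (B.tgt e))⁻¹ := by group
        _ = _ := by rw [h]; group)
    (fun e he => by rw [hτ e he, mul_inv_cancel])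
  refine ⟨ι, ?_, fun v => ⟨τ v, hι₁ v⟩⟩
  have hletter : ∀ e, B.Realizes (B.src e) (B.tgt e) (B.t e) (B.rose.letter (e, true)) :=
    fun e => LabelledRose.realizes_letterPerm (R := B.rose) B.orientedLetter_rev (e, true)
  -- the potential realizes the paths in the spanning tree, which are trivial in `G`
  have hpot : ∀ u v, B.Realizes u v 1 ((τ u)⁻¹ * τ v : B.rose.group) := by
    intro u v
    induction B.spans u v with
    | rel x y hxy =>
      obtain ⟨e, he, rfl, rfl⟩ := hxy
      rw [← hτ e he, inv_mul_cancel_left, ← B.t_eq_one e he]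
      exact hletter e
    | refl x =>
      rw [inv_mul_cancel]
      exact LabelledRose.Realizes.one (R := B.rose) x
    | symm x y _ ih =>
      have := LabelledRose.Realizes.inv (R := B.rose) ih
      rwa [inv_one, ← Subgroup.coe_inv, mul_inv_rev, inv_inv] at this
    | trans x y z _ _ ih ih' =>
      have := LabelledRose.Realizes.mul (R := B.rose) ih ih'
      rwa [one_mul, ← Subgroup.coe_mul, mul_assoc, mul_inv_cancel_left] at this
  let v₀ : V := Classical.arbitrary V
  have hmul : ∀ {u v w : V} {g h : G} {m m' : B.rose.group}, B.Realizes u v g m →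
      B.Realizes v w h m' → B.Realizes u w (g * h) (m * m' : B.rose.group) :=
    fun H H' => LabelledRose.Realizes.mul (R := B.rose) H H'
  have hbase : ∀ v, B.Realizes v v (B.a v) B.rose.base :=
    LabelledRose.realizes_basePerm (R := B.rose) B.a_mul_orientedLetter
  have key : ∀ g, B.Realizes v₀ v₀ g ((τ v₀)⁻¹ * ι g * τ v₀ : B.rose.group) := by
    intro g
    have hg : g ∈ Subgroup.closure (Set.range B.a ∪ Set.range B.t) := by simp [B.closure_eq_top]
    induction hg using Subgroup.closure_induction with
    | mem x hx =>
      rcases hx with ⟨v, rfl⟩ | ⟨e, rfl⟩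
      · have := hmul (hmul (hpot v₀ v) (hbase v)) (hpot v v₀)
        rw [one_mul, mul_one] at this
        rw [hι₁]
        simpa only [mul_assoc] using this
      · have := hmul (hmul (hpot v₀ (B.src e)) (hletter e)) (hpot (B.tgt e) v₀)
        rw [one_mul, mul_one] at this
        rw [hι₂]
        simpa only [mul_assoc] using this
    | one =>
      rw [map_one, mul_one, inv_mul_cancel]
      exact LabelledRose.Realizes.one (R := B.rose) v₀
    | mul x y _ _ hx hy =>
      have := hmul hx hy
      rw [map_mul]
      simpa only [mul_assoc, mul_inv_cancel_left] using this
    | inv x _ hx =>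
      have := LabelledRose.Realizes.inv (R := B.rose) hx
      rw [← Subgroup.coe_inv] at this
      rw [map_inv]
      simpa only [mul_inv_rev, inv_inv, mul_assoc] using this
  rw [injective_iff_map_eq_one]
  intro g hg
  have := key g
  rw [hg, mul_one, inv_mul_cancel] at this
  exact LabelledRose.Realizes.eq_one (R := B.rose) this

/-- A GBS group acts on a tree with commutative vertex stabilizers that are commensurable to all the
vertex groups; vertex groups are infinite cyclic and fix a vertex. -/
lemma exists_tree [Finite E] [Nonempty V] :
    (∀ v (k : ℤ), B.a v ^ k = 1 → k = 0) ∧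
    ∃ (X : Type) (_ : MulAction G X) (T : DirectedTree X),
      (∀ (g : G) {x y : X}, T.Adj x y → T.Adj (g • x) (g • y)) ∧
      (∀ (g h : G) (x : X), g • x = x → h • x = x → Commute g h) ∧
      (∀ v, ∃ x : X, B.a v • x = x) ∧
      ∀ (g : G) (x : X) (v : V), g • x = x →
        ∃ i k : ℤ, i ≠ 0 ∧ g ^ i = B.a v ^ k ∧ (g ≠ 1 → k ≠ 0) := by
  obtain ⟨ι, hι, hτ⟩ := B.exists_embedding
  choose τ hτ using hτ
  refine ⟨fun v k h => ?_, B.rose.Vertex, MulAction.compHom _ ι, B.rose.tree, ?_⟩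
  · have := congrArg ι h
    rw [map_zpow, hτ, conj_zpow, map_one, mul_inv_eq_one, mul_eq_left] at this
    exact B.rose.base_zpow_eq_one this
  let _ : MulAction G B.rose.Vertex := MulAction.compHom _ ι
  have hsmul : ∀ (g : G) (x : B.rose.Vertex), g • x = ι g • x := fun _ _ => rfl
  refine ⟨fun g x y h => LabelledRose.TreeAdj.smul B.rose h (ι g), ?_, fun v => ?_, ?_⟩
  · intro g h x hg hh
    induction x using QuotientGroup.induction_on with
    | H m =>
      obtain ⟨k, hk⟩ := B.rose.exists_eq_conj_of_smul_eq hg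
      obtain ⟨l, hl⟩ := B.rose.exists_eq_conj_of_smul_eq hh
      apply hι
      rw [map_mul, map_mul, hk, hl]
      group
  · refine ⟨QuotientGroup.mk (τ v), ?_⟩
    rw [hsmul, hτ]
    change (QuotientGroup.mk (τ v * B.rose.base * (τ v)⁻¹ * τ v) : B.rose.Vertex) = _
    rw [inv_mul_cancel_right]
    exact (QuotientGroup.eq.2 (by simp)).symm
  · intro g x v hg
    induction x using QuotientGroup.induction_on with
    | H m =>
      obtain ⟨k, hk⟩ := B.rose.exists_eq_conj_of_smul_eq hg
      obtain ⟨i, j, hi, hj, hij⟩ := B.rose.exists_base_zpow_conj ((τ v)⁻¹ * m)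
      refine ⟨i, j * k, hi, ?_, fun h1 => mul_ne_zero hj ?_⟩
      · apply hι
        rw [map_zpow, map_zpow, hk, hτ, conj_zpow, conj_zpow, zpow_mul, ← hij, conj_zpow,
          ← zpow_mul, ← zpow_mul, mul_comm k]
        group
      · rintro rfl
        apply h1
        apply hι
        rw [hk, map_one]
        simp

end GBSPresentation

/-! ### Central elements and the invariant -/

/-- If `φ` does not vanish on a central element, then a path joining `1` to `g` can be pushed into
the non-negative part by translating it by a power of that element. -/
lemma mem_bnsInvariant_of_mem_center {G : Type*} [Group G] {S : Set G} (hf : S.Finite)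
    (hS : Subgroup.closure S = ⊤) {φ : Character G} (hφ : φ ≠ 0) {z : G}
    (hz : z ∈ Subgroup.center G) (hφz : φ (Additive.ofMul z) ≠ 0) :
    rayOfNeZero ℝ φ hφ ∈ bnsInvariant G := by
  wlog hpos : 0 < φ (Additive.ofMul z) generalizing z
  · refine this (inv_mem hz) (by rwa [ofMul_inv, map_neg, neg_ne_zero]) ?_
    rw [ofMul_inv, map_neg]
    exact neg_pos.2 (lt_of_le_of_ne (not_lt.1 hpos) hφz)
  have hS' : Subgroup.closure (insert z S) = ⊤ :=
    top_unique (hS ▸ Subgroup.closure_mono (Set.subset_insert z S))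
  refine (mem_bnsInvariant_iff (hf.insert z) hS' φ hφ).2 ?_
  have hpow : ∀ (N : ℕ) (g : G), 0 ≤ φ (Additive.ofMul g) →
      BNSAux.Joined (insert z S) φ g (g * z ^ N) := by
    intro N g hg
    induction N with
    | zero => simpa using BNSAux.joined_refl hg
    | succ N ih =>
      have h1 : 0 ≤ φ (Additive.ofMul (g * z ^ N * z)) := by
        rw [ofMul_mul, map_add]
        exact add_nonneg ih.2.1 hpos.le
      rw [pow_succ, ← mul_assoc]
      exact ih.trans (BNSAux.joined_mul (Set.mem_insert z S) ih.2.1 h1)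
  have hone : (0 : ℝ) ≤ φ (Additive.ofMul (1 : G)) := by simp
  have hmain : ∀ g : G, 0 ≤ φ (Additive.ofMul g) → BNSAux.Joined (insert z S) φ 1 g := by
    intro g hg
    obtain ⟨C, hC⟩ := BNSAux.exists_bound (φ := φ) hS' g
    obtain ⟨N, hN⟩ := Archimedean.arch C hpos
    have h1 := hpow N 1 hone
    have h2 := hC (z ^ N) (by rwa [ofMul_pow, map_nsmul])
    rw [one_mul] at h1
    rw [(Subgroup.mem_center_iff.1 (pow_mem hz N) g).symm] at h2
    exact (h1.trans h2).trans (hpow N g hg).symm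
  refine (SimpleGraph.connected_iff _).2 ⟨?_, ⟨⟨1, hone⟩⟩⟩
  rintro ⟨a, ha⟩ ⟨b, hb⟩
  obtain ⟨_, _, h⟩ := (hmain a ha).symm.trans (hmain b hb)
  exact h

lemma Character.mul_eq_mul_of_zpow_eq {G : Type*} [Group G] (φ : Character G) {g h : G} {i k : ℤ}
    (e : g ^ i = h ^ k) : i * φ (Additive.ofMul g) = k * φ (Additive.ofMul h) := by
  have := congrArg (fun x => φ (Additive.ofMul x)) e
  simpa only [ofMul_zpow, map_zsmul, zsmul_eq_mul] using this

/-- If the conjugates of `a` are commensurable to `a` and some character does not vanish at `a`,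
then conjugation fixes powers of `a`, so that some power of `a` is central. -/
lemma exists_zpow_mem_center {G : Type*} [Group G] {S : Set G} (hf : S.Finite)
    (hS : Subgroup.closure S = ⊤) {a : G}
    (ha : ∀ g : G, ∃ i k : ℤ, i ≠ 0 ∧ (g * a * g⁻¹) ^ i = a ^ k) {φ : Character G}
    (hφ : φ (Additive.ofMul a) ≠ 0) : ∃ j : ℤ, j ≠ 0 ∧ a ^ j ∈ Subgroup.center G := by
  choose i k hi hik using ha
  have hcomm : ∀ g, Commute (a ^ i g) g := by
    intro g
    have h := φ.mul_eq_mul_of_zpow_eq (hik g)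
    rw [ofMul_mul, ofMul_mul, ofMul_inv, map_add, map_add, map_neg, add_neg_cancel_comm] at h
    have h' : i g = k g := by exact_mod_cast mul_right_cancel₀ hφ h
    have h2 := hik g
    rw [← h', conj_zpow, mul_inv_eq_iff_eq_mul] at h2
    exact h2.symm
  refine ⟨∏ g ∈ hf.toFinset, i g, Finset.prod_ne_zero_iff.2 fun g _ => hi g, ?_⟩
  set j := ∏ g ∈ hf.toFinset, i g with hj
  have hle : Subgroup.closure S ≤ Subgroup.centralizer {a ^ j} := by
    rw [Subgroup.closure_le]
    intro s hs
    obtain ⟨l, hl⟩ : i s ∣ j := Finset.dvd_prod_of_mem i (hf.mem_toFinset.2 hs)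
    rw [SetLike.mem_coe, Subgroup.mem_centralizer_singleton_iff, hl, zpow_mul]
    exact ((hcomm s).zpow_left l).symm
  rw [hS, top_le_iff] at hle
  rw [Subgroup.mem_center_iff]
  intro g
  have : g ∈ Subgroup.centralizer {a ^ j} := hle ▸ Subgroup.mem_top g
  exact Subgroup.mem_centralizer_singleton_iff.1 this

/-- If a power of a vertex generator is central, then there is a character that does not vanish
at this generator: it is trivial on the stable letters, and its values on the vertex generators are
given by the commensurability ratios. -/
lemma GBSPresentation.exists_character {G : Type*} [Group G] {V E : Type}
    (B : GBSPresentation G V E) {v₀ : V} (hinf : ∀ k : ℤ, B.a v₀ ^ k = 1 → k = 0)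
    (hcom : ∀ v, ∃ i k : ℤ, i ≠ 0 ∧ k ≠ 0 ∧ B.a v ^ i = B.a v₀ ^ k) {j : ℤ} (hj : j ≠ 0)
    (hcen : B.a v₀ ^ j ∈ Subgroup.center G) :
    ∃ φ : Character G, φ (Additive.ofMul (B.a v₀)) ≠ 0 := by
  choose i k hi hk hik using hcom
  have hrel : ∀ e, (B.p e : ℝ) * (k (B.src e) / i (B.src e)) =
      B.q e * (k (B.tgt e) / i (B.tgt e)) := by
    intro e
    have h1 : B.a (B.src e) ^ (B.p e * (i (B.src e) * i (B.tgt e) * j)) =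
        (B.a v₀ ^ j) ^ (k (B.src e) * B.p e * i (B.tgt e)) := by
      rw [show B.p e * (i (B.src e) * i (B.tgt e) * j) =
        i (B.src e) * (B.p e * i (B.tgt e) * j) by ring, zpow_mul, hik, ← zpow_mul, ← zpow_mul]
      congr 1
      ring
    have h2 : B.a (B.tgt e) ^ (B.q e * (i (B.src e) * i (B.tgt e) * j)) =
        (B.a v₀ ^ j) ^ (k (B.tgt e) * B.q e * i (B.src e)) := by
      rw [show B.q e * (i (B.src e) * i (B.tgt e) * j) =
        i (B.tgt e) * (B.q e * i (B.src e) * j) by ring, zpow_mul, hik, ← zpow_mul, ← zpow_mul]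
      congr 1
      ring
    have h3 := congrArg (· ^ (i (B.src e) * i (B.tgt e) * j)) (B.rel e)
    have hconj := conj_zpow (i := i (B.src e) * i (B.tgt e) * j) (a := (B.t e)⁻¹)
      (b := B.a (B.src e) ^ B.p e)
    rw [inv_inv] at hconj
    simp only [hconj, ← zpow_mul] at h3
    rw [h1, h2, mul_assoc, ← Subgroup.mem_center_iff.1 (zpow_mem hcen _), inv_mul_cancel_left,
      ← zpow_mul, ← zpow_mul, ← mul_inv_eq_one, ← zpow_neg, ← zpow_add] at h3
    have h4 := hinf _ h3
    have h5 : k (B.src e) * B.p e * i (B.tgt e) = k (B.tgt e) * B.q e * i (B.src e) := by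
      apply mul_left_cancel₀ hj
      linarith
    have h6 : (k (B.src e) * B.p e * i (B.tgt e) : ℝ) = k (B.tgt e) * B.q e * i (B.src e) := by
      exact_mod_cast h5
    have hs : (i (B.src e) : ℝ) ≠ 0 := by exact_mod_cast hi _
    have ht : (i (B.tgt e) : ℝ) ≠ 0 := by exact_mod_cast hi _
    field_simp
    linarith
  obtain ⟨f, hf, -⟩ := B.exists_lift (P := Multiplicative ℝ)
    (fun v => Multiplicative.ofAdd (k v / i v : ℝ)) (fun _ => 1)
    (fun e => by
      rw [inv_one, one_mul, mul_one, ← ofAdd_zsmul, ← ofAdd_zsmul, zsmul_eq_mul, zsmul_eq_mul,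
        hrel])
    (fun _ _ => rfl)
  refine ⟨MonoidHom.toAdditiveLeft f, ?_⟩
  change (f (B.a v₀)).toAdd ≠ 0
  rw [hf, toAdd_ofAdd]
  exact div_ne_zero (by exact_mod_cast hk _) (by exact_mod_cast hi _)

/-- The characters vanishing at an element where some character does not vanish form a rationally
defined subspace of codimension one. -/
lemma exists_rational_hyperplane {G : Type*} [Group G] z {φ₀ : Character G}
    (h : φ₀ (Additive.ofMul z) ≠ 0) : ∃ W : Submodule ℝ (Character G),
      IsRationallyDefined W ∧ Module.rank ℝ (Character G ⧸ W) = 1 ∧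
      ∀ φ, φ ∈ W ↔ φ (Additive.ofMul z) = 0 := by
  let ev : Character G →ₗ[ℝ] ℝ :=
    { toFun := fun φ => φ (Additive.ofMul z)
      map_add' := fun _ _ => rfl
      map_smul' := fun _ _ => rfl }
  have hev : Function.Surjective ev := by
    intro r
    refine ⟨(r / φ₀ (Additive.ofMul z)) • φ₀, ?_⟩
    change (r / φ₀ (Additive.ofMul z)) * φ₀ (Additive.ofMul z) = r
    exact div_mul_cancel₀ r h
  refine ⟨LinearMap.ker ev, ⟨{Finsupp.single z 1}, Set.finite_singleton _, fun φ => ?_⟩, ?_,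
    fun φ => Iff.rfl⟩
  · simp [ev]
  · rw [Module.rank_eq_one_iff_finrank_eq_one, (ev.quotKerEquivOfSurjective hev).finrank_eq,
      Module.finrank_self]

/-! ### The invariant of a non-solvable GBS group -/

theorem proposition3 {G : Type*} [Group G] (hG : IsGBS G) (hns : ¬ Group.IsSolvable G) :
    bnsInvariant G = (subsphere (Subgroup.center G : Set G))ᶜ ∧
    (Subgroup.center G = ⊥ → bnsInvariant G = ∅) ∧
    (Subgroup.center G ≠ ⊥ → IsRationalSubsphere 1 (bnsInvariant G)ᶜ) := by
  obtain ⟨V, E, _, _, ⟨v₀⟩, ⟨B⟩⟩ := hG.exists_presentation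
  have hfin : (Set.range B.a ∪ Set.range B.t).Finite :=
    (Set.finite_range _).union (Set.finite_range _)
  have : Nonempty V := ⟨v₀⟩
  obtain ⟨hinf, X, _, T, hT, hcomm, hfix, hstab⟩ := B.exists_tree
  obtain ⟨x₀, hx₀⟩ := hfix v₀
  have hcenter : ∀ z ∈ Subgroup.center G,
      ∃ i k : ℤ, i ≠ 0 ∧ z ^ i = B.a v₀ ^ k ∧ (z ≠ 1 → k ≠ 0) := by
    intro z hz
    by_contra h
    exact hns (T.isSolvable_of_central hT hcomm x₀ hz fun x hx => h (hstab z x v₀ hx))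
  have hconj : ∀ g : G, ∃ i k : ℤ, i ≠ 0 ∧ (g * B.a v₀ * g⁻¹) ^ i = B.a v₀ ^ k := by
    intro g
    obtain ⟨i, k, hi, hik, -⟩ := hstab (g * B.a v₀ * g⁻¹) (g • x₀) v₀
      (by rw [mul_smul, inv_smul_smul, mul_smul, hx₀])
    exact ⟨i, k, hi, hik⟩
  have hzero : ∀ (φ : Character G) (g : G), φ (Additive.ofMul (B.a v₀)) = 0 →
      (∃ i k : ℤ, i ≠ 0 ∧ g ^ i = B.a v₀ ^ k) → φ (Additive.ofMul g) = 0 := by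
    rintro φ g h ⟨i, k, hi, hik⟩
    have := φ.mul_eq_mul_of_zpow_eq hik
    rw [h, mul_zero] at this
    exact (mul_eq_zero.1 this).resolve_left (by exact_mod_cast hi)
  have hmain : bnsInvariant G = (subsphere (Subgroup.center G : Set G))ᶜ := by
    ext x
    induction x using Module.Ray.ind with
    | h φ hφ =>
      rw [Set.mem_compl_iff, mem_subsphere_iff]
      constructor
      · intro hmem hcen
        rw [mem_bnsInvariant_iff hfin B.closure_eq_top] at hmem
        by_cases ha : φ (Additive.ofMul (B.a v₀)) = 0
        · refine hns (T.isSolvable_of_nonnegCayley_connected hT hcomm x₀ hfin hφ hmem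
            fun g x hg => ?_)
          obtain ⟨i, k, hi, hik, -⟩ := hstab g x v₀ hg
          exact hzero φ g ha ⟨i, k, hi, hik⟩
        · obtain ⟨j, hj, hja⟩ := exists_zpow_mem_center hfin B.closure_eq_top hconj ha
          have := hcen _ hja
          rw [ofMul_zpow, map_zsmul, zsmul_eq_mul] at this
          exact mul_ne_zero (by exact_mod_cast hj) ha this
      · intro h
        push Not at h
        obtain ⟨z, hz, hφz⟩ := h
        exact mem_bnsInvariant_of_mem_center hfin B.closure_eq_top hφ hz hφz
  refine ⟨hmain, fun hbot => ?_, fun hbot => ?_⟩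
  · rw [hmain, hbot, Set.eq_empty_iff_forall_notMem]
    intro x
    induction x using Module.Ray.ind with
    | h φ hφ =>
      rw [Set.mem_compl_iff, not_not, mem_subsphere_iff]
      rintro _ rfl
      simp
  · obtain ⟨⟨z, hz⟩, hz'⟩ := Subgroup.ne_bot_iff_exists_ne_one.1 hbot
    have hz1 : z ≠ 1 := fun e => hz' (Subtype.ext e)
    obtain ⟨i, k, hi, hik, hk⟩ := hcenter _ hz
    have hk := hk hz1
    have hcom : ∀ v, ∃ i k : ℤ, i ≠ 0 ∧ k ≠ 0 ∧ B.a v ^ i = B.a v₀ ^ k := by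
      intro v
      obtain ⟨x, hx⟩ := hfix v
      obtain ⟨i, k, hi, hik, hk⟩ := hstab _ x v₀ hx
      refine ⟨i, k, hi, hk fun h => ?_, hik⟩
      exact one_ne_zero (hinf v 1 (by rw [zpow_one, h]))
    obtain ⟨φ₀, hφ₀⟩ := B.exists_character (hinf v₀) hcom hk (hik ▸ zpow_mem hz i)
    -- a character vanishes at `z` if and only if it vanishes at `a v₀`
    have hiff : ∀ φ : Character G, φ (Additive.ofMul z) = 0 ↔
        φ (Additive.ofMul (B.a v₀)) = 0 := by
      refine fun φ => ⟨fun h => ?_, fun h => hzero φ z h ⟨i, k, hi, hik⟩⟩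
      have := φ.mul_eq_mul_of_zpow_eq hik
      rw [h, mul_zero] at this
      exact (mul_eq_zero.1 this.symm).resolve_left (by exact_mod_cast hk)
    obtain ⟨W, hW₁, hW₂, hW₃⟩ := exists_rational_hyperplane z (mt (hiff φ₀).1 hφ₀)
    refine ⟨W, hW₁, by rw [hW₂, Nat.cast_one], ?_⟩
    rw [hmain, compl_compl]
    ext x
    refine exists_congr fun φ => exists_congr fun hφ => and_congr_right fun _ => ?_
    rw [hW₃]
    refine ⟨fun h => h z hz, fun h g hg => ?_⟩
    obtain ⟨i', k', hi', hik', -⟩ := hcenter g hg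
    exact hzero φ g ((hiff φ).1 h) ⟨i', k', hi', hik'⟩
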